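/- Let $G$ be a countable discrete Abelian group that contains an element of infinite order. Then there are a standard Borel space $X$, a $\sigma$-finite measure $\mu$ on $X$ with $\mu(X)=\infty$, and a $\mu$-preserving action $T=(T_g)_{g\in G}$ of $G$ on $X$ such that, with $T^{-1}:=(T_{-g})_{g\in G}$: 1. $T$ is of funny rank one, i.e. there are finite sets $F_n\subset G$ and measurable sets $A_n\subset X$ of finite measure, $n\ge 1$, such that for each $n$ the sets $T_gA_n$, $g\in F_n$, are pairwise disjoint, and for each measurable $B$ with $\mu(B)<\infty$ there are $D_n\subset F_n$ with $\mu\big(B\,\triangle\,\bigcup_{g\in D_n}T_gA_n\big)\to 0$; 2. $T$ has ergodic index $2$, i.e. the $G$-action $T\times T=(T_g\times T_g)_{g\in G}$ is ergodic and the $G$-action $T\times T\times T=(T_g\times T_g\times T_g)_{g\in G}$ is not ergodic; 3. the $G$-action $T\times T^{-1}=(T_g\times T_{-g})_{g\in G}$ is conservative but not ergodic; 4. the $G$-action $T\times T\times T$ is not conservative; 5. $T$ and $T^{-1}$ are not isomorphic, i.e. no measure preserving map $X\to X$ that is invertible modulo null sets intertwines $T_g$ with $T_{-g}$ almost everywhere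 for every $g\in G$. (An action $(R_g)_{g\in G}$ is conservative if for each measurable set $B$ of positive measure there is $g\ne 0$ such that $R_gB\cap B$ has positive measure.) Furthermore, if $G=\mathbb Z^d$ with $d\ge 1$, then $T$ can in addition be chosen of rank one, i.e. so that 1 holds with each $F_n$ a cube $\prod_{i=1}^d\{a_i,a_i+1,\dots,a_i+N-1\}$. -/

import Mathlib

open MeasureTheory Filter Topology

/-- A measure preserving action `(T_g)_{g ∈ G}` of an additive group `G` on the measure
space `(X, μ)`. -/
structure MPAction (G : Type*) [AddCommGroup G] (X : Type*) [MeasurableSpace X]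
    (μ : Measure X) where
  /-- the transformation `T_g` -/
  toFun : G → X → X
  map_zero : ∀ x, toFun 0 x = x
  map_add : ∀ g h x, toFun (g + h) x = toFun g (toFun h x)
  measurePreserving : ∀ g, MeasurePreserving (toFun g) μ μ

namespace MPAction

/-- The inverse action `T⁻¹ = (T_{-g})_{g ∈ G}`. -/
def inv {G : Type*} [AddCommGroup G] {X : Type*} [MeasurableSpace X] {μ : Measure X}
    (T : MPAction G X μ) : MPAction G X μ where
  toFun g := T.toFun (-g)
  map_zero x := by rw [neg_zero, T.map_zero]
  map_add g h x := by rw [neg_add, T.map_add]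
  measurePreserving g := T.measurePreserving (-g)

/-- The product action `S × R = (S_g × R_g)_{g ∈ G}` of `G`. -/
def prod {G : Type*} [AddCommGroup G] {X Y : Type*} [MeasurableSpace X] [MeasurableSpace Y]
    {μ : Measure X} {ν : Measure Y} [SigmaFinite μ] [SigmaFinite ν]
    (S : MPAction G X μ) (R : MPAction G Y ν) : MPAction G (X × Y) (μ.prod ν) where
  toFun g p := (S.toFun g p.1, R.toFun g p.2)
  map_zero p := by simp [S.map_zero, R.map_zero]
  map_add g h p := by simp [S.map_add, R.map_add]
  measurePreserving g := (S.measurePreserving g).prod (R.measurePreserving g)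

/-- The action `T × ⋯ × T` (`k` times) of `G` on `X^k` with the product measure. -/
noncomputable def power {G : Type*} [AddCommGroup G] {X : Type*} [MeasurableSpace X]
    {μ : Measure X} [SigmaFinite μ] (T : MPAction G X μ) (k : ℕ) :
    MPAction G (Fin k → X) (Measure.pi fun _ => μ) where
  toFun g p := fun i => T.toFun g (p i)
  map_zero p := by simp [T.map_zero]
  map_add g h p := by simp [T.map_add]
  measurePreserving g := measurePreserving_pi _ _ fun _ => T.measurePreserving g

/-- `T` is ergodic: every measurable set that is a.e. invariant under all `T_g` is null or
conull. -/
def IsErgodic {G : Type*} [AddCommGroup G] {X : Type*} [MeasurableSpace X] {μ : Measure X}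
    (T : MPAction G X μ) : Prop :=
  letI : VAdd G X := ⟨T.toFun⟩
  ErgodicVAdd G X μ

/-- `T` is conservative: there is no wandering set of positive measure, that is, every
measurable set `B` of positive measure meets one of its translates by `g ≠ 0` in a set of
positive measure. -/
def IsConservative {G : Type*} [AddCommGroup G] {X : Type*} [MeasurableSpace X]
    {μ : Measure X} (T : MPAction G X μ) : Prop :=
  ∀ B : Set X, MeasurableSet B → μ B ≠ 0 → ∃ g : G, g ≠ 0 ∧ μ (T.toFun g '' B ∩ B) ≠ 0

/-- `T` has ergodic index `k`: `T × ⋯ × T` is ergodic for `k` factors, and not for `k + 1`. -/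
def HasErgodicIndex {G : Type*} [AddCommGroup G] {X : Type*} [MeasurableSpace X]
    {μ : Measure X} [SigmaFinite μ] (T : MPAction G X μ) (k : ℕ) : Prop :=
  (T.power k).IsErgodic ∧ ¬ (T.power (k + 1)).IsErgodic

/-- `T` is of funny rank one along the finite sets `F_n ⊆ G`: there are measurable sets `A_n` of
finite measure such that the sets `T_g A_n`, `g ∈ F_n`, are pairwise disjoint and the towers
`{T_g A_n | g ∈ F_n}` approximate the σ-algebra, i.e. each measurable set of finite measure is
the limit (in measure) of unions of levels of the `n`-th tower. -/
def IsFunnyRankOneAlong {G : Type*} [AddCommGroup G] {X : Type*} [MeasurableSpace X]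
    {μ : Measure X} (T : MPAction G X μ) (F : ℕ → Finset G) : Prop :=
  ∃ A : ℕ → Set X,
    (∀ n, MeasurableSet (A n) ∧ μ (A n) < ⊤) ∧
    (∀ n, ∀ g ∈ F n, ∀ h ∈ F n, g ≠ h → Disjoint (T.toFun g '' A n) (T.toFun h '' A n)) ∧
    ∀ B : Set X, MeasurableSet B → μ B < ⊤ →
      ∃ D : ℕ → Finset G, (∀ n, D n ⊆ F n) ∧
        Tendsto (fun n => μ (symmDiff B (⋃ g ∈ D n, T.toFun g '' A n))) atTop (𝓝 0)

/-- `T` is of funny rank one. -/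
def IsFunnyRankOne {G : Type*} [AddCommGroup G] {X : Type*} [MeasurableSpace X]
    {μ : Measure X} (T : MPAction G X μ) : Prop :=
  ∃ F : ℕ → Finset G, T.IsFunnyRankOneAlong F

/-- An action of `ℤ^d` is of rank one if it is of funny rank one along a sequence of cubes
`∏_i {a_i, a_i + 1, …, a_i + N - 1}`. -/
def IsRankOne {d : ℕ} {X : Type*} [MeasurableSpace X] {μ : Measure X}
    (T : MPAction (Fin d → ℤ) X μ) : Prop :=
  ∃ F : ℕ → Finset (Fin d → ℤ),
    (∀ n, ∃ (a : Fin d → ℤ) (N : ℕ), 0 < N ∧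
      ∀ x : Fin d → ℤ, x ∈ F n ↔ ∀ i, a i ≤ x i ∧ x i < a i + N) ∧
    T.IsFunnyRankOneAlong F

/-- The actions `S` and `R` are isomorphic: there is a measure preserving map that is invertible
modulo null sets and intertwines `S_g` and `R_g` almost everywhere, for each `g`. -/
def IsIsomorphic {G : Type*} [AddCommGroup G] {X Y : Type*} [MeasurableSpace X]
    [MeasurableSpace Y] {μ : Measure X} {ν : Measure Y}
    (S : MPAction G X μ) (R : MPAction G Y ν) : Prop :=
  ∃ (φ : X → Y) (ψ : Y → X), MeasurePreserving φ μ ν ∧ MeasurePreserving ψ ν μ ∧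
    (∀ᵐ x ∂μ, ψ (φ x) = x) ∧ (∀ᵐ y ∂ν, φ (ψ y) = y) ∧
    ∀ g : G, ∀ᵐ x ∂μ, φ (S.toFun g x) = R.toFun g (φ x)

end MPAction

set_option linter.unusedSectionVars false

/-! The action comes from a cutting construction. Given maps `s n : A n → G` on finite groups `A n`,
take `G × ∏ A n` and identify `(g, c)` with `(h, d)` when `c` and `d` agree from some `N` on and `g
+ ∑ s n (c n) = h + ∑ s n (d n)`, the sums over `n < N`. `T` translates the first coordinate, so `X`
is a union of countably many copies `j g` of the probability space `∏ A n`. Changing finitely many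
digits of a point is thus the same as applying a group element.

Everything rests on one dichotomy for `s n`. The only coincidences between sums `s n i + s n i'`,
even modulo the finite set `V n` that holds everything accumulated earlier, are the trivial ones
`{i, i'} = {j, j'}`, unless `i' = i + flip n`. For flipped pairs the sum is constant on each of the
classes `t n i = 0` and `t n i = 1`, and the two constants differ by a prescribed `g`, every `g`
being prescribed infinitely often.

The exchange `(i, i') ↦ (i' + flip, i + flip)` of a pair of digits of types 0 and 1 moves a point of
`X × X` along the diagonal up to the prescribed `g`. It acts on a quarter of every cylinder, and a
density argument makes `T × T` ergodic (`isErgodic_prod`). The plain exchange `(i, i') ↦ (i', i)`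
moves along the antidiagonal, so `T × T⁻¹` is conservative. For pairs without flipped digits
exchanges are the only antidiagonal moves, and they preserve the types of a pair of equal types, so
`T × T⁻¹` is not ergodic. Generic triples cannot be moved at all (`eq_of_triple_sum_eq`), so `T × T
× T` is neither conservative nor ergodic. Since `|A n| = 2 ^ (n + 5)`, the exceptional
configurations have summable small measure.

The remaining claims follow. An isomorphism of `T` with `T⁻¹` would carry ergodicity from `T × T` to
`T × T⁻¹`. A finite `μ` would make `T × T × T` recurrent. The towers have shapes `F n` taken from
any family cofinal among finite sets: all finite sets in general, cubes for `ℤ^d`. -/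

/-- The combinatorial data of the construction: cutting maps `s n : A n → G` which are generic
relative to the finite sets `V n`, up to the symmetry `i ↦ i + flip n`. -/
structure CuttingData (G : Type*) [AddCommGroup G] (A : ℕ → Type) [∀ n, AddCommGroup (A n)] where
  s : ∀ n, A n → G
  flip : ∀ n, A n
  t : ∀ n, A n →+ ZMod 2
  V : ℕ → Finset G
  F : ℕ → Finset G
  zero_mem : 0 ∈ V 0
  neg_mem : ∀ n v, v ∈ V n → -v ∈ V n
  step : ∀ n v, v ∈ V n → ∀ i i' j j', v + (s n i + s n i' - s n j - s n j') ∈ V (n + 1)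
  generic : ∀ n i i' j j', s n i + s n i' - s n j - s n j' ∈ V n → i' ≠ i + flip n →
    (j = i ∧ j' = i') ∨ (j = i' ∧ j' = i)
  flip_add_flip : ∀ n, flip n + flip n = 0
  flip_ne_zero : ∀ n, flip n ≠ 0
  t_surjective : ∀ n, Function.Surjective (t n)
  -- Equivalently, `s n j + s n (j + flip n)` exceeds `s n i + s n (i + flip n)` by `g`. These are
  -- the coincidences that `generic` leaves room for.
  flip_shift : ∀ g, ∃ᶠ n in atTop, ∀ i j, t n i = 0 → t n j = 1 →
    s n (j + flip n) - s n (i + flip n) = s n i - s n j + g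
  sub_mem : ∀ n, ∀ g ∈ F n, ∀ h ∈ F n, g - h ∈ V n
  exhaust : ∀ g, ∀ᶠ n in atTop, ∀ c : ∀ n, A n, g + ∑ m ∈ Finset.range n, s m (c m) ∈ F n

/-! ### Existence of the cutting maps -/

/-- Uniqueness of balanced base 9 expansions: the lowest digit is divisible by 9 and at most 4 in
absolute value. -/
theorem eq_zero_of_sum_mul_pow_nine_eq_zero (n : ℕ) (x : ℕ → ℤ) (hx : ∀ k, |x k| ≤ 4)
    (h : ∑ k ∈ Finset.range n, x k * 9 ^ k = 0) : ∀ k < n, x k = 0 := by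
  induction n generalizing x with
  | zero => simp
  | succ n ih =>
    rw [Finset.sum_range_succ'] at h
    have h9 : ∑ k ∈ Finset.range n, x (k + 1) * 9 ^ (k + 1)
        = 9 * ∑ k ∈ Finset.range n, x (k + 1) * 9 ^ k := by
      rw [Finset.mul_sum]
      exact Finset.sum_congr rfl fun k _ => by ring
    rw [h9] at h
    have h0 := abs_le.1 (hx 0)
    have hx0 : x 0 = 0 := by simp at h; omega
    have := ih (fun k => x (k + 1)) (fun k => hx _) (by simp [hx0] at h; exact h)
    intro k hk
    cases k with
    | zero => exact hx0
    | succ k => exact this k (by omega)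

/-- Collecting equal powers leaves coefficients of absolute value at most 4, so each of them
vanishes. The condition `hab` rules out that the first two terms cancel each other, which would
leave `c` and `d` undetermined. -/
theorem pair_eq_of_signed_pow_nine_eq {a b c d : ℕ} {e₁ e₂ e₃ e₄ : ℤ}
    (h₁ : e₁ = 1 ∨ e₁ = -1) (h₂ : e₂ = 1 ∨ e₂ = -1) (h₃ : e₃ = 1 ∨ e₃ = -1)
    (h₄ : e₄ = 1 ∨ e₄ = -1)
    (h : e₁ * 9 ^ a + e₂ * 9 ^ b - e₃ * 9 ^ c - e₄ * 9 ^ d = 0) (hab : a = b → e₁ + e₂ ≠ 0) :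
    (c = a ∧ e₃ = e₁ ∧ d = b ∧ e₄ = e₂) ∨ (c = b ∧ e₃ = e₂ ∧ d = a ∧ e₄ = e₁) := by
  set x : ℕ → ℤ := fun k => (if k = a then e₁ else 0) + (if k = b then e₂ else 0)
    - (if k = c then e₃ else 0) - (if k = d then e₄ else 0) with hx
  have hle : ∀ k, |x k| ≤ 4 := by
    intro k
    rw [abs_le]
    simp only [hx]
    split_ifs <;> omega
  have hsum : ∑ k ∈ Finset.range (a + b + c + d + 1), x k * 9 ^ k = 0 := by
    rw [← h]
    simp only [hx, sub_mul, add_mul, ite_mul, zero_mul, Finset.sum_sub_distrib,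
      Finset.sum_add_distrib, Finset.sum_ite_eq', Finset.mem_range]
    rw [if_pos (by omega), if_pos (by omega), if_pos (by omega), if_pos (by omega)]
  have hz := eq_zero_of_sum_mul_pow_nine_eq_zero _ x hle hsum
  have ha := hz a (by omega)
  have hb := hz b (by omega)
  have hc := hz c (by omega)
  have hd := hz d (by omega)
  simp only [hx] at ha hb hc hd
  clear hz hsum hle hx h x
  grind (splits := 20)

theorem exists_int_bound_of_zsmul_mem {G : Type*} [AddCommGroup G] {z : G}
    (hz : ¬ IsOfFinAddOrder z) (W : Finset G) :
    ∃ M : ℤ, 0 < M ∧ ∀ r : ℤ, r • z ∈ W → |r| < M := by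
  have hinj : Function.Injective fun r : ℤ => r • z := injective_zsmul_iff_not_isOfFinAddOrder.2 hz
  have hfin : {r : ℤ | r • z ∈ W}.Finite := W.finite_toSet.preimage hinj.injOn
  obtain ⟨M, hM⟩ := (hfin.image (fun r => |r|)).bddAbove
  refine ⟨max M 0 + 1, by positivity, fun r hr => ?_⟩
  have : |r| ≤ M := hM ⟨r, hr, rfl⟩
  have := le_max_left M 0
  omega

/-- The alphabets of the construction. -/
abbrev Alphabet (n : ℕ) : Type := ZMod 2 × ZMod 2 × ZMod (2 ^ (n + 3))

/-- Take `s i = ± M 9 ^ idx i • z + e i`, where the flip changes only the sign and `e` is a small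
correction. Then `s i + s (i + flip)` is `0` on type 0 and `g` on type 1. With `M` larger than every
multiple of `z` met in the thickened set `W'`, a combination in `W` must have integer coefficient 0,
and base 9 uniqueness applies. -/
theorem exists_generic_cut {G : Type*} [AddCommGroup G] {z : G}
    (hz : ¬ IsOfFinAddOrder z) (W : Finset G) (g : G) (n : ℕ) :
    ∃ s : Alphabet n → G,
      (∀ i j : Alphabet n, i.2.1 = 0 → j.2.1 = 1 →
        s (j + (1, 0)) - s (i + (1, 0)) = s i - s j + g) ∧
      ∀ i i' j j', s i + s i' - s j - s j' ∈ W → i' ≠ i + (1, 0) →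
        (j = i ∧ j' = i') ∨ (j = i' ∧ j' = i) := by
  classical
  let E : Finset G := {0, g}
  -- `W'` contains all values left after the four corrections are removed from an element of `W`.
  let W' : Finset G := (W ×ˢ E ×ˢ E ×ˢ E ×ˢ E).image
    fun p => p.1 - (p.2.1 + p.2.2.1 - p.2.2.2.1 - p.2.2.2.2)
  obtain ⟨M, hM0, hM⟩ := exists_int_bound_of_zsmul_mem hz W'
  let idx : Alphabet n → ℕ := fun i => 2 * i.2.2.val + i.2.1.val
  let sgn : Alphabet n → ℤ := fun i => if i.1 = 0 then 1 else -1
  let e : Alphabet n → G := fun i => if i.1 = 1 ∧ i.2.1 = 1 then g else 0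
  have z2 : ∀ a : ZMod 2, a = 0 ∨ a = 1 := by decide
  have hsgn : ∀ i, sgn i = 1 ∨ sgn i = -1 := fun i => by
    simp only [sgn]; split_ifs <;> simp
  have hidx : ∀ i j, idx i = idx j → i.2 = j.2 := by
    intro i j h
    have hi := ZMod.val_lt i.2.1
    have hj := ZMod.val_lt j.2.1
    simp only [idx] at h
    refine Prod.ext (ZMod.val_injective _ (by omega)) (ZMod.val_injective _ (by omega))
  have hsgn' : ∀ i j, sgn i = sgn j → i.1 = j.1 := by
    intro i j h
    simp only [sgn] at h
    rcases z2 i.1 with hi | hi <;> rcases z2 j.1 with hj | hj <;> simp_all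
  have hsgn_add : ∀ i j, sgn i + sgn j = 0 → j.1 = i.1 + 1 := by
    intro i j h
    have h1 : (1 : ZMod 2) + 1 = 0 := by decide
    simp only [sgn] at h
    rcases z2 i.1 with hi | hi <;> rcases z2 j.1 with hj | hj <;> simp [hi, hj, h1] at h ⊢
  have he : ∀ i, e i ∈ E := fun i => by simp only [e, E]; split_ifs <;> simp
  refine ⟨fun i => (sgn i * (M * 9 ^ idx i)) • z + e i, ?_, ?_⟩
  · rintro ⟨a, b, i⟩ ⟨a', b', j⟩ hi hj
    simp only at hi hj
    subst hi hj
    have h1 : (1 : ZMod 2) + 1 = 0 := by decide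
    rcases z2 a with rfl | rfl <;> rcases z2 a' with rfl | rfl <;>
      simp [sgn, e, idx, h1] <;> abel
  · intro i i' j j' h hne
    have hK : sgn i * 9 ^ idx i + sgn i' * 9 ^ idx i' - sgn j * 9 ^ idx j - sgn j' * 9 ^ idx j'
        = 0 := by
      by_contra hK
      set K := sgn i * 9 ^ idx i + sgn i' * 9 ^ idx i' - sgn j * 9 ^ idx j
        - sgn j' * 9 ^ idx j' with hKdef
      have hmem : (M * K) • z ∈ W' := by
        refine Finset.mem_image.2 ⟨(((sgn i * (M * 9 ^ idx i)) • z + e i) +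
          ((sgn i' * (M * 9 ^ idx i')) • z + e i') - ((sgn j * (M * 9 ^ idx j)) • z + e j) -
          ((sgn j' * (M * 9 ^ idx j')) • z + e j'), e i, e i', e j, e j'), ?_, ?_⟩
        · simp only [Finset.mem_product]
          exact ⟨h, he _, he _, he _, he _⟩
        · simp only [hKdef]
          have : M * (sgn i * 9 ^ idx i + sgn i' * 9 ^ idx i' - sgn j * 9 ^ idx j
            - sgn j' * 9 ^ idx j') = sgn i * (M * 9 ^ idx i) + sgn i' * (M * 9 ^ idx i')
            - sgn j * (M * 9 ^ idx j) - sgn j' * (M * 9 ^ idx j') := by ring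
          rw [this]
          simp only [sub_smul, add_smul]
          abel
      have h1 := hM _ hmem
      rw [abs_mul, abs_of_pos hM0] at h1
      have h2 : 1 ≤ |K| := Int.one_le_abs hK
      nlinarith
    have key := pair_eq_of_signed_pow_nine_eq (hsgn i) (hsgn i') (hsgn j) (hsgn j') hK (by
      intro hab hs
      refine hne (Prod.ext (hsgn_add _ _ hs) ?_)
      rw [← hidx _ _ hab]
      exact (add_zero i.2).symm)
    rcases key with ⟨h1, h2, h3, h4⟩ | ⟨h1, h2, h3, h4⟩
    · exact Or.inl ⟨Prod.ext (hsgn' _ _ h2) (hidx _ _ h1), Prod.ext (hsgn' _ _ h4) (hidx _ _ h3)⟩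
    · exact Or.inr ⟨Prod.ext (hsgn' _ _ h2) (hidx _ _ h1), Prod.ext (hsgn' _ _ h4) (hidx _ _ h3)⟩

theorem exists_seq_frequently_eq (G : Type*) [Countable G] [Nonempty G] :
    ∃ f : ℕ → G, ∀ g, ∃ᶠ n in atTop, f n = g := by
  obtain ⟨f, hf⟩ := exists_surjective_nat G
  refine ⟨fun n => f n.unpair.1, fun g => ?_⟩
  obtain ⟨k, rfl⟩ := hf g
  refine frequently_atTop.2 fun N => ⟨Nat.pair k N, Nat.right_le_pair _ _, by simp⟩

/-- The recursion carries two finite sets: the sums of the cuts made so far, and the combinations in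
which elements of the previous `V` can end up. From them come first `F n`, then a symmetric `V n`
containing `F n - F n`, and only then a cut generic relative to `V n`. -/
theorem exists_cuttingData {G : Type*} [AddCommGroup G] [Countable G] {z : G}
    (hz : ¬ IsOfFinAddOrder z) (𝓕 : Set (Finset G)) (h𝓕 : ∀ E : Finset G, ∃ F ∈ 𝓕, E ⊆ F) :
    ∃ S : CuttingData G Alphabet, ∀ n, S.F n ∈ 𝓕 := by
  classical
  choose enl enl_mem sub_enl using h𝓕
  obtain ⟨f, hf⟩ := exists_surjective_nat G
  obtain ⟨g, hg⟩ := exists_seq_frequently_eq G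
  choose cut cut_shift cut_generic using fun W g n => exists_generic_cut hz W g n
  let F : ℕ → Finset G × Finset G → Finset G := fun n p =>
    enl ((((Finset.range n).image f) ×ˢ p.1).image fun q => q.1 + q.2)
  let R : ℕ → Finset G × Finset G → Finset G := fun n p =>
    p.2 ∪ (F n p ×ˢ F n p).image fun q => q.1 - q.2
  let V : ℕ → Finset G × Finset G → Finset G := fun n p => R n p ∪ (R n p).image fun x => -x
  let s : ∀ n, Finset G × Finset G → Alphabet n → G := fun n p => cut (V n p) (g n) n
  let next : ℕ → Finset G × Finset G → Finset G × Finset G := fun n p =>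
    ((p.1 ×ˢ Finset.univ).image fun q : G × Alphabet n => q.1 + s n p q.2,
      (V n p ×ˢ Finset.univ).image fun q : G × Alphabet n × Alphabet n × Alphabet n × Alphabet n =>
        q.1 + (s n p q.2.1 + s n p q.2.2.1 - s n p q.2.2.2.1 - s n p q.2.2.2.2))
  let st : ℕ → Finset G × Finset G := fun n => Nat.rec ({0}, {0}) next n
  have st_succ : ∀ n, st (n + 1) = next n (st n) := fun n => rfl
  have sub_V : ∀ n p, p.2 ⊆ V n p := fun n p x hx =>
    Finset.mem_union_left _ (Finset.mem_union_left _ hx)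
  have sums : ∀ (c : ∀ n, Alphabet n) n,
      ∑ m ∈ Finset.range n, s m (st m) (c m) ∈ (st n).1 := by
    intro c n
    induction n with
    | zero => simp [st]
    | succ n ih =>
      rw [Finset.sum_range_succ, st_succ]
      exact Finset.mem_image.2 ⟨(_, c n), Finset.mem_product.2 ⟨ih, Finset.mem_univ _⟩, rfl⟩
  refine ⟨{ s := fun n => s n (st n), flip := fun n => (1, 0),
            t := fun n => (AddMonoidHom.fst _ _).comp (AddMonoidHom.snd _ _),
            V := fun n => V n (st n), F := fun n => F n (st n), zero_mem := ?_, neg_mem := ?_,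
            step := ?_, generic := ?_, flip_add_flip := ?_, flip_ne_zero := ?_, t_surjective := ?_,
            flip_shift := ?_, sub_mem := ?_, exhaust := ?_ }, fun n => enl_mem _⟩
  · exact sub_V 0 _ (by simp [st])
  · intro n v hv
    simp only [V, Finset.mem_union, Finset.mem_image] at hv ⊢
    rcases hv with hv | ⟨x, hx, rfl⟩
    · exact Or.inr ⟨v, hv, rfl⟩
    · exact Or.inl (by simpa using hx)
  · intro n v hv i i' j j'
    refine sub_V _ _ ?_
    rw [st_succ]
    exact Finset.mem_image.2 ⟨(v, i, i', j, j'), Finset.mem_product.2 ⟨hv, Finset.mem_univ _⟩, rfl⟩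
  · exact fun n => cut_generic _ _ _
  · intro n
    have h1 : (1 : ZMod 2) + 1 = 0 := by decide
    simp [h1]
  · intro n h
    have : (1 : ZMod 2) = 0 := congrArg Prod.fst h
    exact absurd this (by decide)
  · exact fun n y => ⟨(0, y, 0), rfl⟩
  · intro y
    refine (hg y).mono ?_
    rintro n rfl i j hi hj
    exact cut_shift _ _ _ i j hi hj
  · intro n x hx y hy
    refine Finset.mem_union_left _ (Finset.mem_union_right _ ?_)
    exact Finset.mem_image.2 ⟨(x, y), by simp [hx, hy], rfl⟩
  · intro x
    obtain ⟨k, rfl⟩ := hf x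
    filter_upwards [eventually_gt_atTop k] with n hn c
    refine sub_enl _ (Finset.mem_image.2 ⟨(f k, _), ?_, rfl⟩)
    exact Finset.mem_product.2 ⟨Finset.mem_image.2 ⟨k, by simpa using hn, rfl⟩, sums c n⟩

/-! ### Translation invariant probability measures and finite quotients -/

section Quotient

variable {Z B : Type*} [AddCommGroup Z] [MeasurableSpace Z] [MeasurableAdd Z]
  [AddCommGroup B] [Finite B] [MeasurableSpace B] [DiscreteMeasurableSpace B]
  {m : Measure Z} [m.IsAddLeftInvariant]

/-- A set which is invariant under lifts of all elements of a finite quotient `B` is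
equidistributed over `B`. -/
theorem card_mul_measureReal_inter_fiber [IsFiniteMeasure m] (f : Z →+ B) (hf : Measurable f) {E : Set Z}
    (hE : ∀ b, ∃ z, f z = b ∧ ∀ x, z + x ∈ E ↔ x ∈ E) (b : B) :
    (Nat.card B : ℝ) * m.real (E ∩ f ⁻¹' {b}) = m.real E := by
  classical
  have := Fintype.ofFinite B
  have hfib : ∀ b', m.real (E ∩ f ⁻¹' {b'}) = m.real (E ∩ f ⁻¹' {b}) := by
    intro b'
    obtain ⟨z, hz, hzE⟩ := hE (b' - b)
    simp only [Measure.real]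
    rw [← measure_preimage_add m z (E ∩ f ⁻¹' {b'})]
    congr 2
    ext x
    simp [hzE, hz, sub_add_eq_add_sub, sub_eq_iff_eq_add, add_comm b']
  have hsum : ∑ b', m.real (E ∩ f ⁻¹' {b'}) = m.real E := by
    have h := sum_measureReal_preimage_singleton (μ := m.restrict E) (f := f) Finset.univ
      (fun y _ => (hf (measurableSet_singleton y)))
    simp only [Finset.coe_univ, Set.preimage_univ] at h
    rw [measureReal_restrict_apply MeasurableSet.univ, Set.univ_inter] at h
    rw [← h]
    refine Finset.sum_congr rfl fun b' _ => ?_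
    rw [measureReal_restrict_apply (hf (measurableSet_singleton _)), Set.inter_comm]
  rw [← hsum]
  simp [hfib, Nat.card_eq_fintype_card]

/-- Permuting the fibres of a finite quotient by translations preserves the measure. -/
theorem measurePreserving_permute_fibers (f : Z →+ B) (hf : Measurable f) (σ : B →+ Z)
    (hσ : ∀ b, f (σ b) = b) (β : Equiv.Perm B) :
    MeasurePreserving (fun z => σ (β (f z) - f z) + z) m m := by
  classical
  have := Fintype.ofFinite B
  have hmeas : Measurable fun z => σ (β (f z) - f z) + z := by
    have h : Measurable fun p : B × Z => σ (β p.1 - p.1) + p.2 :=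
      measurable_from_prod_countable_right fun b => measurable_const_add (σ (β b - b))
    exact h.comp (hf.prodMk measurable_id)
  refine ⟨hmeas, Measure.ext fun E hE => ?_⟩
  rw [Measure.map_apply hmeas hE]
  have key : ∀ E : Set Z, MeasurableSet E → m E = ∑ b, m (E ∩ f ⁻¹' {b}) := by
    intro E hE
    have h := sum_measure_preimage_singleton (μ := m.restrict E) (f := f) Finset.univ
      (fun y _ => (hf (measurableSet_singleton y)))
    simp only [Finset.coe_univ, Set.preimage_univ, Measure.restrict_apply_univ] at h
    rw [← h]
    refine Finset.sum_congr rfl fun b' _ => ?_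
    rw [Measure.restrict_apply (hf (measurableSet_singleton _)), Set.inter_comm]
  rw [key _ (hmeas hE), key E hE,
    ← Equiv.sum_comp β (fun b => m (E ∩ f ⁻¹' {b}))]
  refine Finset.sum_congr rfl fun b _ => ?_
  rw [← measure_preimage_add m (σ (β b - b)) (E ∩ f ⁻¹' {β b})]
  congr 1
  ext x
  simp only [Set.mem_inter_iff, Set.mem_preimage, Set.mem_singleton_iff, map_add, hσ]
  constructor
  · rintro ⟨h1, rfl⟩
    exact ⟨h1, by abel⟩
  · rintro ⟨h1, h2⟩
    have : f x = b := by
      have h3 : f x - b = 0 := by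
        rw [← sub_eq_zero] at h2
        rw [← h2]; abel
      exact sub_eq_zero.1 h3
    subst this
    exact ⟨h1, rfl⟩

end Quotient

/-! ### Approximation along a generating sequence of finite partitions -/

section Approximation

variable {Z : Type*} [mZ : MeasurableSpace Z] {R : ℕ → Type*}
  (m : Measure Z) [IsFiniteMeasure m] (r : ∀ n, Z → R n)

/-- The preimages of sets under the refining maps `r n` form an algebra generating the σ-algebra,
hence are dense in measure. -/
theorem exists_preimage_symmDiff_lt
    (hr : ∀ n (U : Set (R n)), MeasurableSet (r n ⁻¹' U))
    (href : ∀ n k, n ≤ k → ∀ x y, r k x = r k y → r n x = r n y)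
    (hgen : mZ ≤ MeasurableSpace.generateFrom {E | ∃ n U, E = r n ⁻¹' U})
    {E : Set Z} (hE : MeasurableSet E) {ε : ℝ} (hε : 0 < ε) :
    ∃ N, ∀ n ≥ N, ∃ U : Set (R n), m.real (symmDiff E (r n ⁻¹' U)) < ε := by
  have up : ∀ n k, n ≤ k → ∀ U : Set (R n), ∃ U' : Set (R k), r n ⁻¹' U = r k ⁻¹' U' := by
    intro n k hnk U
    refine ⟨r k '' (r n ⁻¹' U), Set.Subset.antisymm (Set.subset_preimage_image _ _) ?_⟩
    rintro x ⟨y, hy, hxy⟩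
    simpa [href n k hnk y x hxy] using hy
  have halg : IsSetAlgebra {E | ∃ n U, E = r n ⁻¹' U} := by
    refine ⟨⟨0, ∅, by simp⟩, ?_, ?_⟩
    · rintro _ ⟨n, U, rfl⟩
      exact ⟨n, Uᶜ, rfl⟩
    · rintro _ _ ⟨n, U, rfl⟩ ⟨k, W, rfl⟩
      obtain ⟨U', hU'⟩ := up n (max n k) (le_max_left _ _) U
      obtain ⟨W', hW'⟩ := up k (max n k) (le_max_right _ _) W
      exact ⟨max n k, U' ∪ W', by rw [hU', hW', Set.preimage_union]⟩
  have hgen' : mZ = MeasurableSpace.generateFrom {E | ∃ n U, E = r n ⁻¹' U} := by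
    refine le_antisymm hgen (MeasurableSpace.generateFrom_le ?_)
    rintro _ ⟨n, U, rfl⟩
    exact hr n U
  have hdense := Measure.MeasureDense.of_generateFrom_isSetAlgebra_finite (μ := m) halg hgen'
  obtain ⟨_, ⟨N, U, rfl⟩, hU⟩ := hdense.approx E hE (measure_ne_top _ _) ε hε
  refine ⟨N, fun n hn => ?_⟩
  obtain ⟨U', hU'⟩ := up N n hn U
  refine ⟨U', ?_⟩
  rw [← hU']
  exact (ENNReal.toReal_lt_of_lt_ofReal hU)

/-- Density points: a set of positive measure nearly fills some atom of every sufficiently fine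
partition. -/
theorem exists_fiber_diff_lt [∀ n, Finite (R n)]
    (hr : ∀ n (U : Set (R n)), MeasurableSet (r n ⁻¹' U))
    (href : ∀ n k, n ≤ k → ∀ x y, r k x = r k y → r n x = r n y)
    (hgen : mZ ≤ MeasurableSpace.generateFrom {E | ∃ n U, E = r n ⁻¹' U})
    {E : Set Z} (hE : MeasurableSet E) (hE0 : m E ≠ 0) {δ : ℝ} (hδ : 0 < δ) :
    ∃ N, ∀ n ≥ N, ∃ a, m.real (r n ⁻¹' {a} \ E) < δ * m.real (r n ⁻¹' {a}) := by
  have hpos : 0 < m.real E := ENNReal.toReal_pos hE0 (measure_ne_top _ _)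
  -- The first bound gives `U` measure above `m E / 2`. If every atom in `U` lost a fraction `δ`,
  -- the loss would exceed the second bound.
  have hε : 0 < min (m.real E / 2) (δ * m.real E / 2) := by positivity
  obtain ⟨N, hN⟩ := exists_preimage_symmDiff_lt m r hr href hgen hE hε
  refine ⟨N, fun n hn => ?_⟩
  obtain ⟨U, hU⟩ := hN n hn
  have := Fintype.ofFinite (R n)
  classical
  by_contra! hcon
  have h1 : m.real (E \ r n ⁻¹' U) ≤ m.real (symmDiff E (r n ⁻¹' U)) :=
    measureReal_mono (by rw [Set.symmDiff_def]; exact Set.subset_union_left)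
  have h2 : m.real (r n ⁻¹' U \ E) ≤ m.real (symmDiff E (r n ⁻¹' U)) :=
    measureReal_mono (by rw [Set.symmDiff_def]; exact Set.subset_union_right)
  have h3 : m.real E ≤ m.real (E \ r n ⁻¹' U) + m.real (r n ⁻¹' U) :=
    (measureReal_mono (by intro x hx; by_cases h : x ∈ r n ⁻¹' U <;> simp_all)).trans
      (measureReal_union_le _ _)
  have hsum : ∀ ν : Measure Z, [IsFiniteMeasure ν] →
      ν.real (r n ⁻¹' U) = ∑ a ∈ U.toFinset, ν.real (r n ⁻¹' {a}) := by
    intro ν _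
    rw [sum_measureReal_preimage_singleton _ (fun a _ => hr n {a})]
    simp
  have h4 : δ * m.real (r n ⁻¹' U) ≤ m.real (r n ⁻¹' U \ E) := by
    have h5 := hsum (m.restrict Eᶜ)
    rw [measureReal_restrict_apply (hr n U)] at h5
    rw [Set.sdiff_eq, h5, hsum m, Finset.mul_sum]
    refine Finset.sum_le_sum fun a _ => ?_
    rw [measureReal_restrict_apply (hr n _)]
    exact hcon a
  have h6 := min_le_left (m.real E / 2) (δ * m.real E / 2)
  have h7 := min_le_right (m.real E / 2) (δ * m.real E / 2)
  nlinarith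

end Approximation

/-! ### The space of digit sequences -/

section Digits

variable {A : ℕ → Type}

/-- The first `n` digits. -/
def digits (n : ℕ) (c : ∀ n, A n) : ∀ k : Fin n, A k := fun k => c k

theorem digits_eq_iff {n : ℕ} {c d : ∀ n, A n} :
    digits n c = digits n d ↔ ∀ k < n, c k = d k :=
  ⟨fun h k hk => congrFun h ⟨k, hk⟩, fun h => funext fun k => h k k.2⟩

theorem digits_eq_of_le {n k : ℕ} (h : n ≤ k) {c d : ∀ n, A n} (hcd : digits k c = digits k d) :
    digits n c = digits n d :=
  digits_eq_iff.2 fun i hi => digits_eq_iff.1 hcd i (hi.trans_le h)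

variable [∀ n, MeasurableSpace (A n)]

theorem measurable_digits (n : ℕ) : Measurable (digits (A := A) n) :=
  measurable_pi_lambda _ fun k => measurable_pi_apply (k : ℕ)

/-- The first `n` digits of a pair. -/
def digitsPair (n : ℕ) (p : (∀ n, A n) × (∀ n, A n)) : (∀ k : Fin n, A k) × (∀ k : Fin n, A k) :=
  (digits n p.1, digits n p.2)

theorem measurable_digitsPair (n : ℕ) : Measurable (digitsPair (A := A) n) :=
  ((measurable_digits n).comp measurable_fst).prodMk ((measurable_digits n).comp measurable_snd)

theorem le_generateFrom_digits :
    (MeasurableSpace.pi : MeasurableSpace (∀ n, A n)) ≤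
      MeasurableSpace.generateFrom {E | ∃ n U, E = digits (A := A) n ⁻¹' U} := by
  refine iSup_le fun n => ?_
  rintro _ ⟨U, -, rfl⟩
  exact MeasurableSpace.measurableSet_generateFrom
    ⟨n + 1, {w | w ⟨n, n.lt_succ_self⟩ ∈ U}, rfl⟩

theorem le_generateFrom_digitsPair :
    (Prod.instMeasurableSpace : MeasurableSpace ((∀ n, A n) × (∀ n, A n))) ≤
      MeasurableSpace.generateFrom {E | ∃ n U, E = digitsPair (A := A) n ⁻¹' U} := by
  refine sup_le ?_ ?_
  · rw [MeasurableSpace.pi, MeasurableSpace.comap_iSup]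
    refine iSup_le fun n => ?_
    rintro _ ⟨_, ⟨U, -, rfl⟩, rfl⟩
    exact MeasurableSpace.measurableSet_generateFrom
      ⟨n + 1, {w | w.1 ⟨n, n.lt_succ_self⟩ ∈ U}, rfl⟩
  · rw [MeasurableSpace.pi, MeasurableSpace.comap_iSup]
    refine iSup_le fun n => ?_
    rintro _ ⟨_, ⟨U, -, rfl⟩, rfl⟩
    exact MeasurableSpace.measurableSet_generateFrom
      ⟨n + 1, {w | w.2 ⟨n, n.lt_succ_self⟩ ∈ U}, rfl⟩

variable [∀ n, DiscreteMeasurableSpace (A n)] [∀ n, Finite (A n)]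
  (P : Measure (∀ n, A n)) [IsProbabilityMeasure P]

theorem exists_digits_symmDiff_lt {E : Set (∀ n, A n)} (hE : MeasurableSet E) {ε : ℝ}
    (hε : 0 < ε) :
    ∃ N, ∀ n ≥ N, ∃ U : Set (∀ k : Fin n, A k), P.real (symmDiff E (digits n ⁻¹' U)) < ε :=
  exists_preimage_symmDiff_lt P digits (fun n _ => measurable_digits n (.of_discrete))
    (fun _ _ h _ _ => digits_eq_of_le h) le_generateFrom_digits hE hε

theorem exists_digitsPair_diff_lt {E : Set ((∀ n, A n) × (∀ n, A n))} (hE : MeasurableSet E)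
    (hE0 : P.prod P E ≠ 0) {δ : ℝ} (hδ : 0 < δ) :
    ∃ N, ∀ n ≥ N, ∃ a, (P.prod P).real (digitsPair n ⁻¹' {a} \ E) <
      δ * (P.prod P).real (digitsPair n ⁻¹' {a}) :=
  exists_fiber_diff_lt (P.prod P) digitsPair (fun n _ => measurable_digitsPair n (.of_discrete))
    (fun _ _ h _ _ hxy => Prod.ext (digits_eq_of_le h (congrArg Prod.fst hxy))
      (digits_eq_of_le h (congrArg Prod.snd hxy))) le_generateFrom_digitsPair hE hE0 hδ

end Digits

theorem exists_invariant_probability (A : ℕ → Type) [∀ n, AddCommGroup (A n)]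
    [∀ n, MeasurableSpace (A n)] [∀ n, DiscreteMeasurableSpace (A n)] [∀ n, Finite (A n)] :
    ∃ P : Measure (∀ n, A n), IsProbabilityMeasure P ∧ P.IsAddLeftInvariant := by
  have := fun n => Fintype.ofFinite (A n)
  refine ⟨Measure.infinitePi fun n => ProbabilityTheory.uniformOn Set.univ, inferInstance,
    ⟨fun c => ?_⟩⟩
  have h := Measure.infinitePi_map_pi
    (fun n => ProbabilityTheory.uniformOn (Set.univ : Set (A n)))
    (f := fun n x => c n + x) (fun n => measurable_const_add _)
  refine h.trans ?_
  congr 1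
  funext n
  refine Measure.ext fun E hE => ?_
  rw [Measure.map_apply (measurable_const_add _) hE, ProbabilityTheory.uniformOn_univ,
    ProbabilityTheory.uniformOn_univ]
  congr 1
  exact measure_preimage_add _ _ _

/-! ### The quotient by a countable group acting with a strict fundamental domain -/

section StrictDomain

open scoped Pointwise

variable {Y Γ : Type*} [AddGroup Γ] [AddAction Γ Y] {D : Set Y}
  (hD : ∀ y : Y, ∃! γ : Γ, γ +ᵥ y ∈ D)

/-- The projection to a strict fundamental domain. -/
noncomputable def domainProj (y : Y) : D := ⟨(hD y).choose +ᵥ y, (hD y).choose_spec.1⟩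

theorem domainProj_val (y : Y) : ∃ γ : Γ, (domainProj hD y : Y) = γ +ᵥ y := ⟨_, rfl⟩

theorem domainProj_eq_of_vadd_mem {y : Y} {γ : Γ} (h : γ +ᵥ y ∈ D) :
    domainProj hD y = ⟨γ +ᵥ y, h⟩ := by
  refine Subtype.ext ?_
  change (hD y).choose +ᵥ y = γ +ᵥ y
  rw [← (hD y).choose_spec.2 γ h]

theorem domainProj_of_mem {y : Y} (h : y ∈ D) : domainProj hD y = ⟨y, h⟩ := by
  rw [domainProj_eq_of_vadd_mem hD (γ := 0) (by rwa [zero_vadd])]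
  simp

theorem domainProj_vadd (γ : Γ) (y : Y) : domainProj hD (γ +ᵥ y) = domainProj hD y := by
  obtain ⟨γ', h⟩ := domainProj_val hD (γ +ᵥ y)
  have h' : (γ' + γ) +ᵥ y ∈ D := by
    rw [add_vadd, ← h]
    exact (domainProj hD (γ +ᵥ y)).2
  rw [domainProj_eq_of_vadd_mem hD h']
  exact Subtype.ext (h.trans (add_vadd _ _ _).symm)

theorem domainProj_eq_iff {y y' : Y} :
    domainProj hD y = domainProj hD y' ↔ ∃ γ : Γ, γ +ᵥ y = y' := by
  constructor
  · intro h
    obtain ⟨γ, hγ⟩ := domainProj_val hD y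
    obtain ⟨γ', hγ'⟩ := domainProj_val hD y'
    refine ⟨-γ' + γ, ?_⟩
    rw [add_vadd, ← hγ, h, hγ', neg_vadd_vadd]
  · rintro ⟨γ, rfl⟩
    rw [domainProj_vadd]

theorem domainProj_vadd_comm {G : Type*} [AddCommGroup G] [AddAction G Y] [VAddCommClass G Γ Y]
    (g : G) (y : Y) :
    domainProj hD (g +ᵥ (domainProj hD y : Y)) = domainProj hD (g +ᵥ y) := by
  obtain ⟨γ, hγ⟩ := domainProj_val hD y
  rw [hγ, vadd_comm, domainProj_vadd]

variable [MeasurableSpace Y]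

theorem comap_val_apply (m : Measure Y) (hDm : MeasurableSet D) (B : Set D) :
    m.comap Subtype.val B = m (domainProj hD ⁻¹' B ∩ D) := by
  rw [comap_subtype_coe_apply hDm]
  congr 1
  ext y
  constructor
  · rintro ⟨x, hx, rfl⟩
    exact ⟨by simpa [domainProj_of_mem hD x.2] using hx, x.2⟩
  · rintro ⟨h1, h2⟩
    rw [Set.mem_preimage, domainProj_of_mem hD h2] at h1
    exact ⟨_, h1, rfl⟩

variable [MeasurableConstVAdd Γ Y] [Countable Γ]

theorem measurable_domainProj (hDm : MeasurableSet D) : Measurable (domainProj hD) := by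
  rintro _ ⟨E, hE, rfl⟩
  have : domainProj hD ⁻¹' (Subtype.val ⁻¹' E) = ⋃ γ : Γ, (fun y => γ +ᵥ y) ⁻¹' (E ∩ D) := by
    ext y
    simp only [Set.mem_preimage, Set.mem_iUnion, Set.mem_inter_iff]
    constructor
    · intro h
      obtain ⟨γ, hγ⟩ := domainProj_val hD y
      exact ⟨γ, hγ ▸ h, hγ ▸ (domainProj hD y).2⟩
    · rintro ⟨γ, h1, h2⟩
      rwa [domainProj_eq_of_vadd_mem hD h2]
  rw [this]
  exact MeasurableSet.iUnion fun γ => measurable_const_vadd γ (hE.inter hDm)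

variable {m : Measure Y} [VAddInvariantMeasure Γ Y m]

/-- A set `S` meeting each orbit at most once is cut by the translates of `D` into pieces that the
projection moves disjointly and without change of measure. This identifies the measure on each copy
`j g` with `P`. -/
theorem comap_val_inter_image (hDm : MeasurableSet D) {S : Set Y} (hS : MeasurableSet S)
    (hSu : ∀ y ∈ S, ∀ γ : Γ, γ +ᵥ y ∈ S → γ = 0) {B : Set D} (hB : MeasurableSet B) :
    m.comap Subtype.val (B ∩ domainProj hD '' S) = m (domainProj hD ⁻¹' B ∩ S) := by
  have hfund : IsAddFundamentalDomain Γ D m := .mk' hDm.nullMeasurableSet hD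
  have hBm := measurable_domainProj hD hDm hB
  rw [comap_val_apply hD m hDm, hfund.measure_eq_tsum (domainProj hD ⁻¹' B ∩ S), ← measure_iUnion]
  · congr 1
    ext y
    simp only [Set.mem_inter_iff, Set.mem_preimage, Set.mem_iUnion, Set.mem_image]
    constructor
    · rintro ⟨⟨h1, x, hx, hxy⟩, h2⟩
      obtain ⟨γ, rfl⟩ := (domainProj_eq_iff hD).1 hxy
      exact ⟨γ, Set.vadd_mem_vadd_set ⟨by rwa [Set.mem_preimage, hxy], hx⟩, h2⟩
    · rintro ⟨γ, ⟨x, ⟨hx1, hx2⟩, rfl⟩, h2⟩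
      exact ⟨⟨by simpa [domainProj_vadd] using hx1, x, hx2, by simp [domainProj_vadd]⟩, h2⟩
  · intro γ γ' hne
    refine Set.disjoint_left.2 ?_
    rintro _ ⟨⟨x, hx, rfl⟩, -⟩ ⟨⟨x', hx', hxx'⟩, -⟩
    refine hne ?_
    simp only at hxx'
    have h1 : (-γ' + γ) +ᵥ x = x' := by rw [add_vadd, ← hxx', neg_vadd_vadd]
    have := hSu x hx.2 (-γ' + γ) (h1 ▸ hx'.2)
    exact (neg_add_eq_zero.1 this).symm
  · exact fun γ => ((hBm.inter hS).const_vadd γ).inter hDm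

/-- A measure preserving action commuting with the action of `Γ` descends to the domain. -/
noncomputable def domainAction (G : Type*) [AddCommGroup G] [AddAction G Y]
    [MeasurableConstVAdd G Y] [VAddInvariantMeasure G Y m] [VAddCommClass G Γ Y]
    (hDm : MeasurableSet D) : MPAction G D (m.comap Subtype.val) where
  toFun g x := domainProj hD (g +ᵥ (x : Y))
  map_zero x := by rw [zero_vadd, domainProj_of_mem hD x.2]
  map_add g h x := by rw [domainProj_vadd_comm, add_vadd]
  measurePreserving g := by
    have hπ := measurable_domainProj hD hDm
    have hmeas : Measurable fun x : D => domainProj hD (g +ᵥ (x : Y)) :=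
      hπ.comp ((measurable_const_vadd g).comp measurable_subtype_coe)
    refine ⟨hmeas, Measure.ext fun B hB => ?_⟩
    rw [Measure.map_apply hmeas hB, comap_val_apply hD m hDm, comap_val_apply hD m hDm]
    have hfund : IsAddFundamentalDomain Γ D m := .mk' hDm.nullMeasurableSet hD
    -- Since the two actions commute, `g +ᵥ D` is again a fundamental domain, and a `Γ`-invariant
    -- set has the same measure in both.
    rw [hfund.measure_set_eq (hfund.vadd_of_comm g) (hπ hB)]
    · rw [← measure_preimage_vadd m g (domainProj hD ⁻¹' B ∩ (g +ᵥ D))]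
      congr 1
      ext y
      simp only [Set.mem_inter_iff, Set.mem_preimage, domainProj_vadd_comm,
        Set.vadd_mem_vadd_set_iff]
    · intro γ
      ext y
      simp [domainProj_vadd]

end StrictDomain

/-! ### Enveloping actions of tail equivalence cocycles -/

section Skew

variable {G : Type} [AddCommGroup G] {A : ℕ → Type} [∀ n, AddCommGroup (A n)]

/-- A realization of the enveloping action of the tail equivalence relation on `∀ n, A n` with the
cocycle given by `s`: the space is the union of the translates of one copy of `∀ n, A n`. -/
structure Envelope [∀ n, MeasurableSpace (A n)] (s : ∀ n, A n → G) (P : Measure (∀ n, A n))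
    {X : Type} [MeasurableSpace X] {μ : Measure X} (T : MPAction G X μ) where
  j : G → (∀ n, A n) → X
  measurable_j : ∀ g, Measurable (j g)
  toFun_j : ∀ g h c, T.toFun g (j h c) = j (g + h) c
  exists_eq : ∀ x, ∃ g c, j g c = x
  j_eq_iff : ∀ g h c d, j g c = j h d ↔ ∃ N, (∀ n ≥ N, c n = d n) ∧
    g + ∑ n ∈ Finset.range N, s n (c n) = h + ∑ n ∈ Finset.range N, s n (d n)
  map_j : ∀ g, P.map (j g) = μ.restrict (Set.range (j g))

/-- The finitely supported sequences. -/
def finSupported (A : ℕ → Type) [∀ n, AddCommGroup (A n)] : AddSubgroup (∀ n, A n) where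
  carrier := {γ | ∃ N, ∀ n ≥ N, γ n = 0}
  zero_mem' := ⟨0, fun _ _ => rfl⟩
  add_mem' := by
    rintro a b ⟨N, hN⟩ ⟨M, hM⟩
    exact ⟨max N M, fun n hn => by
      simp [hN n (le_of_max_le_left hn), hM n (le_of_max_le_right hn)]⟩
  neg_mem' := by
    rintro a ⟨N, hN⟩
    exact ⟨N, fun n hn => by simp [hN n hn]⟩

instance [∀ n, Finite (A n)] : Countable (finSupported A) := by
  have : (finSupported A : Set (∀ n, A n)) = ⋃ N, {γ | ∀ n ≥ N, γ n = 0} := by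
    ext γ; simp [finSupported]
  refine Set.Countable.to_subtype (s := (finSupported A : Set (∀ n, A n))) ?_
  rw [this]
  refine Set.countable_iUnion fun N => Set.Finite.countable ?_
  refine Set.Finite.of_injOn (f := digits N) (t := Set.univ) (fun _ _ => Set.mem_univ _) ?_
    Set.finite_univ
  intro a ha b hb hab
  funext n
  rcases lt_or_ge n N with hn | hn
  · exact digits_eq_iff.1 hab n hn
  · rw [ha n hn, hb n hn]

/-- The cocycle of the tail equivalence relation defined by `s`. -/
noncomputable def tailCocycle (s : ∀ n, A n → G) (γ c : ∀ n, A n) : G :=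
  ∑ᶠ n, (s n (γ n + c n) - s n (c n))

theorem tailCocycle_eq (s : ∀ n, A n → G) {γ : ∀ n, A n} {N : ℕ} (h : ∀ n ≥ N, γ n = 0)
    (c : ∀ n, A n) :
    tailCocycle s γ c = ∑ n ∈ Finset.range N, (s n (γ n + c n) - s n (c n)) := by
  refine finsum_eq_sum_of_support_subset _ fun n hn => ?_
  by_contra hn'
  simp only [Finset.coe_range, Set.mem_Iio, not_lt] at hn'
  simp [h n hn'] at hn

/-- The product `G × ∀ n, A n` with the action of `finSupported A` twisted by `s`. -/
def Skew (_ : ∀ n, A n → G) : Type := G × ∀ n, A n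

variable (s : ∀ n, A n → G)

noncomputable instance : AddAction (finSupported A) (Skew s) where
  vadd γ y := (y.1 - tailCocycle s γ y.2, γ + y.2)
  zero_vadd y := by
    refine Prod.ext ?_ (zero_add _)
    change y.1 - tailCocycle s 0 y.2 = y.1
    simp [tailCocycle]
  add_vadd γ γ' y := by
    obtain ⟨N, hN⟩ := γ.2
    obtain ⟨M, hM⟩ := γ'.2
    have h1 : ∀ n ≥ max N M, (γ : ∀ n, A n) n = 0 := fun n hn => hN n (le_of_max_le_left hn)
    have h2 : ∀ n ≥ max N M, (γ' : ∀ n, A n) n = 0 := fun n hn => hM n (le_of_max_le_right hn)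
    refine Prod.ext ?_ (add_assoc _ _ _)
    change y.1 - tailCocycle s (γ + γ') y.2 =
      y.1 - tailCocycle s γ' y.2 - tailCocycle s γ (γ' + y.2)
    rw [tailCocycle_eq s (N := max N M) (fun n hn => by simp [h1 n hn, h2 n hn]),
      tailCocycle_eq s h1, tailCocycle_eq s h2, sub_sub, ← Finset.sum_add_distrib]
    congr 1
    refine Finset.sum_congr rfl fun n _ => ?_
    simp [add_assoc]

instance : AddAction G (Skew s) where
  vadd g y := (g + y.1, y.2)
  zero_vadd _ := Prod.ext (zero_add _) rfl
  add_vadd _ _ _ := Prod.ext (add_assoc _ _ _) rfl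

instance : VAddCommClass G (finSupported A) (Skew s) where
  vadd_comm g γ y := Prod.ext (by
    change g + (y.1 - tailCocycle s γ y.2) = g + y.1 - tailCocycle s γ y.2
    abel) rfl

variable [∀ n, MeasurableSpace (A n)] [MeasurableSpace G]

instance : MeasurableSpace (Skew s) := inferInstanceAs (MeasurableSpace (G × ∀ n, A n))

variable [Countable G] [DiscreteMeasurableSpace G] [∀ n, DiscreteMeasurableSpace (A n)]

theorem measurable_tailCocycle (γ : finSupported A) : Measurable (tailCocycle s γ) := by
  obtain ⟨N, hN⟩ := γ.2
  rw [show tailCocycle s (γ : ∀ n, A n) = _ from funext (tailCocycle_eq s hN)]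
  refine Finset.measurable_fun_sum _ fun n _ => ?_
  exact (Measurable.of_discrete (f := fun x => s n ((γ : ∀ n, A n) n + x) - s n x)).comp
    (measurable_pi_apply n)

instance : MeasurableConstVAdd (finSupported A) (Skew s) where
  measurable_const_vadd γ :=
    (measurable_fst.sub ((measurable_tailCocycle s γ).comp measurable_snd)).prodMk
      (measurable_snd.const_add (γ : ∀ n, A n))

instance : MeasurableConstVAdd G (Skew s) where
  measurable_const_vadd g := (measurable_fst.const_add g).prodMk measurable_snd

variable [∀ n, Finite (A n)]

instance : StandardBorelSpace (Skew s) := inferInstanceAs (StandardBorelSpace (G × ∀ n, A n))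

/-- The product of the counting measure and `P`. -/
noncomputable def skewMeasure (P : Measure (∀ n, A n)) : Measure (Skew s) :=
  (Measure.count : Measure G).prod P

variable (P : Measure (∀ n, A n)) [IsProbabilityMeasure P]

instance : SigmaFinite (skewMeasure s P) :=
  inferInstanceAs (SigmaFinite ((Measure.count : Measure G).prod P))

instance : VAddInvariantMeasure G (Skew s) (skewMeasure s P) where
  measure_preimage_vadd g _ hE :=
    ((measurePreserving_add_left (Measure.count : Measure G) g).prod
      (MeasurePreserving.id P)).measure_preimage hE.nullMeasurableSet

/-- Over each fixed sequence the map is a translation of `G`; on the sequences it is the translation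
by `γ`. -/
theorem measure_twisted_preimage [P.IsAddLeftInvariant] (γ : finSupported A)
    {E : Set (G × ∀ n, A n)} (hE : MeasurableSet E) :
    (Measure.count : Measure G).prod P
      ((fun y => (y.1 - tailCocycle s γ y.2, (γ : ∀ n, A n) + y.2)) ⁻¹' E) =
    (Measure.count : Measure G).prod P E := by
  have hm : Measurable fun y : G × ∀ n, A n =>
      (y.1 - tailCocycle s γ y.2, (γ : ∀ n, A n) + y.2) :=
    (measurable_fst.sub ((measurable_tailCocycle s γ).comp measurable_snd)).prodMk
      (measurable_snd.const_add (γ : ∀ n, A n))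
  rw [Measure.prod_apply_symm (hm hE), Measure.prod_apply_symm hE,
    ← lintegral_add_left_eq_self (μ := P) (fun c => Measure.count ((fun x => (x, c)) ⁻¹' E)) γ]
  refine lintegral_congr fun c => ?_
  rw [← measure_preimage_add_right (Measure.count : Measure G) (-tailCocycle s γ c)
    ((fun x => (x, (γ : ∀ n, A n) + c)) ⁻¹' E)]
  simp only [← sub_eq_add_neg]
  rfl

instance [P.IsAddLeftInvariant] :
    VAddInvariantMeasure (finSupported A) (Skew s) (skewMeasure s P) where
  measure_preimage_vadd γ _ hE := measure_twisted_preimage s P γ hE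

/-- By `hs` the cocycle vanishes only for `γ = 0`, so the points of one orbit have distinct
`G`-coordinates. Choosing the point whose coordinate has the least code in `ℕ` gives a measurable
strict fundamental domain, which serves as `X`. -/
theorem exists_envelope [P.IsAddLeftInvariant]
    (hs : ∀ N (c d : ∀ n, A n), (∀ n ≥ N, c n = d n) →
      ∑ n ∈ Finset.range N, s n (c n) = ∑ n ∈ Finset.range N, s n (d n) → c = d) :
    ∃ (X : Type) (_ : MeasurableSpace X) (_ : StandardBorelSpace X) (μ : Measure X)
      (_ : SigmaFinite μ) (T : MPAction G X μ), Nonempty (Envelope s P T) := by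
  obtain ⟨code, hcode⟩ := exists_injective_nat G
  have hfree : ∀ (γ : finSupported A) (c : ∀ n, A n), tailCocycle s γ c = 0 → γ = 0 := by
    intro γ c h
    obtain ⟨N, hN⟩ := γ.2
    rw [tailCocycle_eq s hN, Finset.sum_sub_distrib, sub_eq_zero] at h
    have := hs N (γ + c) c (fun n hn => by simp [hN n hn]) h
    exact Subtype.ext (by simpa using this)
  let D : Set (Skew s) := {y | ∀ γ : finSupported A, code y.1 ≤ code (γ +ᵥ y).1}
  have hDm : MeasurableSet D := by
    simp only [D, Set.ofPred_forall]
    refine MeasurableSet.iInter fun γ => ?_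
    have h1 : Measurable fun y : Skew s => code y.1 :=
      (Measurable.of_discrete (f := code)).comp measurable_fst
    have h2 : Measurable fun y : Skew s => code (γ +ᵥ y).1 :=
      h1.comp (measurable_const_vadd γ)
    exact measurableSet_le h1 h2
  have hD : ∀ y : Skew s, ∃! γ : finSupported A, γ +ᵥ y ∈ D := by
    intro y
    obtain ⟨γ, -, hγ⟩ := WellFounded.has_min (measure fun γ : finSupported A =>
      code (γ +ᵥ y).1).wf Set.univ ⟨0, trivial⟩
    have hmin : ∀ γ' : finSupported A, code (γ +ᵥ y).1 ≤ code (γ' +ᵥ y).1 :=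
      fun γ' => not_lt.1 (hγ γ' trivial)
    refine ⟨γ, fun γ' => ?_, fun γ' hγ' => ?_⟩
    · rw [← add_vadd]
      exact hmin _
    · have h1 := hγ' (γ - γ')
      rw [← add_vadd, sub_add_cancel] at h1
      have h2 := hcode (le_antisymm h1 (hmin γ'))
      have h3 : ((γ - γ') +ᵥ (γ' +ᵥ y)).1 = (γ' +ᵥ y).1 := by
        rw [← add_vadd, sub_add_cancel, h2]
      have h4 : tailCocycle s (γ - γ' : finSupported A) (γ' +ᵥ y).2 = 0 := sub_eq_self.1 h3
      exact (sub_eq_zero.1 (hfree _ _ h4)).symm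
  refine ⟨D, inferInstance, hDm.standardBorel, (skewMeasure s P).comap Subtype.val, ?_,
    domainAction hD G hDm, ⟨?_⟩⟩
  · refine SigmaFinite.of_map _ measurable_subtype_coe.aemeasurable ?_
    rw [(MeasurableEmbedding.subtype_coe hDm).map_comap]
    infer_instance
  let ι : G → (∀ n, A n) → Skew s := fun g c => (g, c)
  have hι : ∀ g, Measurable (ι g) := fun g => measurable_prodMk_left
  refine ⟨fun g c => domainProj hD (ι g c), fun g => (measurable_domainProj hD hDm).comp (hι g),
    fun g h c => domainProj_vadd_comm hD g _, fun x => ⟨x.1.1, x.1.2, domainProj_of_mem hD x.2⟩,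
    fun g h c d => ?_, fun g => ?_⟩
  · rw [domainProj_eq_iff hD]
    constructor
    · rintro ⟨γ, hγ⟩
      obtain ⟨N, hN⟩ := γ.2
      have h1 : g - tailCocycle s γ c = h := congrArg Prod.fst hγ
      have h2 : (γ : ∀ n, A n) + c = d := congrArg Prod.snd hγ
      refine ⟨N, fun n hn => by rw [← h2]; simp [hN n hn], ?_⟩
      rw [← h1, ← h2, tailCocycle_eq s hN, Finset.sum_sub_distrib]
      simp only [Pi.add_apply]
      abel
    · rintro ⟨N, hN, hsum⟩
      have hN' : ∀ n ≥ N, (d - c) n = 0 := fun n hn => by simp [hN n hn]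
      refine ⟨⟨d - c, N, hN'⟩, Prod.ext ?_ (sub_add_cancel d c)⟩
      change g - tailCocycle s (d - c) c = h
      rw [tailCocycle_eq s hN', Finset.sum_sub_distrib]
      simp only [Pi.sub_apply, sub_add_cancel]
      rw [sub_sub_eq_add_sub, hsum, add_sub_cancel_right]
  · have hS : MeasurableSet (Set.range (ι g)) :=
      ((hι g).measurableEmbedding (Prod.mk_right_injective g)).measurableSet_range
    have hSu : ∀ y ∈ Set.range (ι g), ∀ γ : finSupported A, γ +ᵥ y ∈ Set.range (ι g) → γ = 0 := by
      rintro _ ⟨c, rfl⟩ γ ⟨d, hd⟩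
      have h1 : g = g - tailCocycle s γ c := congrArg Prod.fst hd
      exact hfree γ c (sub_eq_self.1 h1.symm)
    have hm : Measurable fun c => domainProj hD (ι g c) :=
      (measurable_domainProj hD hDm).comp (hι g)
    refine Measure.ext fun B hB => ?_
    rw [Measure.map_apply hm hB, Measure.restrict_apply hB]
    have := comap_val_inter_image (m := skewMeasure s P) hD hDm hS hSu hB
    rw [← Set.range_comp] at this
    refine Eq.trans ?_ this.symm
    have hset : domainProj hD ⁻¹' B ∩ Set.range (ι g) =
        ({g} : Set G) ×ˢ ((domainProj hD ∘ ι g) ⁻¹' B) := by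
      ext y
      constructor
      · rintro ⟨h, c, rfl⟩
        exact ⟨rfl, h⟩
      · rintro ⟨h1, h2⟩
        obtain ⟨y1, y2⟩ := y
        obtain rfl : y1 = g := h1
        exact ⟨h2, y2, rfl⟩
    rw [hset]
    have h := Measure.prod_prod (μ := (Measure.count : Measure G)) (ν := P) {g}
      ((domainProj hD ∘ ι g) ⁻¹' B)
    rw [Measure.count_singleton, one_mul] at h
    exact h.symm

end Skew

/-! ### Rigidity of generic configurations -/

namespace CuttingData

variable {G : Type*} [AddCommGroup G] {A : ℕ → Type} [∀ n, AddCommGroup (A n)]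
  (S : CuttingData G A)

/-- If the total vanishes, the top digit contributes minus the accumulated sum, which lies in the
symmetric set `V`. By `hQ` this contribution is 0, so the digit can be dropped and the argument
repeated. The index `ι` allows several equations to be used at once. -/
theorem descent {ι : Type*} {n N : ℕ} (hnN : n ≤ N) (x : ι → G) (hx : ∀ a, x a ∈ S.V n)
    (i i' j j' : ι → ∀ k, A k) (Q : ℕ → Prop)
    (hQ : ∀ k ≥ n, (∀ a, S.s k (i a k) + S.s k (i' a k) - S.s k (j a k) - S.s k (j' a k) ∈ S.V k) →
      Q k ∧ ∀ a, S.s k (i a k) + S.s k (i' a k) - S.s k (j a k) - S.s k (j' a k) = 0)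
    (h0 : ∀ a, x a + ∑ k ∈ Finset.Ico n N,
      (S.s k (i a k) + S.s k (i' a k) - S.s k (j a k) - S.s k (j' a k)) = 0) :
    (∀ a, x a = 0) ∧ ∀ k, n ≤ k → k < N → Q k := by
  have hV : ∀ k ≥ n, ∀ a, x a + ∑ k ∈ Finset.Ico n k,
      (S.s k (i a k) + S.s k (i' a k) - S.s k (j a k) - S.s k (j' a k)) ∈ S.V k := by
    intro k hk
    induction k, hk using Nat.le_induction with
    | base => simpa using hx
    | succ k hk ih =>
      intro a
      rw [Finset.sum_Ico_succ_top hk, ← add_assoc]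
      exact S.step k _ (ih a) _ _ _ _
  induction N, hnN using Nat.le_induction with
  | base => exact ⟨by simpa using h0, fun k h1 h2 => by omega⟩
  | succ N hN ih =>
    have hτ : ∀ a, S.s N (i a N) + S.s N (i' a N) - S.s N (j a N) - S.s N (j' a N) ∈ S.V N := by
      intro a
      have h1 := h0 a
      rw [Finset.sum_Ico_succ_top hN, ← add_assoc] at h1
      rw [← neg_eq_of_add_eq_zero_right h1]
      exact S.neg_mem _ _ (hV N hN a)
    obtain ⟨hQN, hz⟩ := hQ N hN hτ
    obtain ⟨h1, h2⟩ := ih fun a => by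
      have h1 := h0 a
      rwa [Finset.sum_Ico_succ_top hN, ← add_assoc, hz a, add_zero] at h1
    refine ⟨h1, fun k hk1 hk2 => ?_⟩
    rcases (Nat.lt_succ_iff_lt_or_eq).1 hk2 with h | rfl
    · exact h2 k hk1 h
    · exact hQN

theorem zero_mem_V (n : ℕ) : 0 ∈ S.V n := by
  induction n with
  | zero => exact S.zero_mem
  | succ n ih => simpa using S.step n 0 ih 0 0 0 0

theorem eq_of_sub_mem {n : ℕ} {i j : A n} (h : S.s n i - S.s n j ∈ S.V n) : j = i := by
  -- Adding and subtracting `s n i` produces a combination of four terms whose positive pair `(i,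
  -- i)` is not flipped.
  have h' : S.s n i + S.s n i - S.s n j - S.s n i ∈ S.V n := by
    convert h using 1; abel
  rcases S.generic n i i j i h' (by simpa using S.flip_ne_zero n) with h | h <;> exact h.1

theorem s_injective (n : ℕ) : Function.Injective (S.s n) := fun i j h =>
  (S.eq_of_sub_mem (by rw [h, sub_self]; exact S.zero_mem_V n)).symm

/-- Elements of `F n` translated by sums of later digits are distinct. -/
theorem eq_of_add_sum_eq {n N : ℕ} (hnN : n ≤ N) {g h : G} (hgh : g - h ∈ S.V n)
    (c d : ∀ k, A k)
    (hsum : g + ∑ k ∈ Finset.Ico n N, S.s k (c k) = h + ∑ k ∈ Finset.Ico n N, S.s k (d k)) :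
    g = h ∧ ∀ k, n ≤ k → k < N → c k = d k := by
  have := S.descent (ι := Unit) hnN (fun _ => g - h) (fun _ => hgh) (fun _ => c) (fun _ => c)
    (fun _ => d) (fun _ => c) (fun k => c k = d k) (fun k _ hk => by
      have h1 : d k = c k := S.eq_of_sub_mem (by convert hk () using 1; abel)
      exact ⟨h1.symm, fun _ => by rw [h1]; abel⟩) (fun _ => by
      have h2 : ∀ k, S.s k (c k) + S.s k (c k) - S.s k (d k) - S.s k (c k) =
        S.s k (c k) - S.s k (d k) := fun k => by abel
      simp only [h2, Finset.sum_sub_distrib]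
      rw [← sub_eq_zero] at hsum
      rw [← hsum]; abel)
  exact ⟨sub_eq_zero.1 (this.1 ()), this.2⟩

theorem sum_injective (N : ℕ) (c d : ∀ n, A n) (hcd : ∀ n ≥ N, c n = d n)
    (h : ∑ n ∈ Finset.range N, S.s n (c n) = ∑ n ∈ Finset.range N, S.s n (d n)) : c = d := by
  have := S.eq_of_add_sum_eq (Nat.zero_le N) (g := 0) (h := 0)
    (by simpa using S.zero_mem) c d (by simpa [← Finset.range_eq_Ico] using h)
  funext n
  rcases lt_or_ge n N with hn | hn
  · exact this.2 n (Nat.zero_le n) hn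
  · exact hcd n hn

/-- Pairs with no flipped digits can only be moved by the antidiagonal by swapping digits. -/
theorem swap_of_sum_add_eq {N : ℕ} (c c' d d' : ∀ n, A n) (hgen : ∀ n, c' n ≠ c n + S.flip n)
    (h : ∑ n ∈ Finset.range N, S.s n (c n) + ∑ n ∈ Finset.range N, S.s n (c' n) =
      ∑ n ∈ Finset.range N, S.s n (d n) + ∑ n ∈ Finset.range N, S.s n (d' n)) :
    ∀ k < N, (d k = c k ∧ d' k = c' k) ∨ (d k = c' k ∧ d' k = c k) := by
  have := S.descent (ι := Unit) (Nat.zero_le N) (fun _ => 0) (fun _ => S.zero_mem) (fun _ => c)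
    (fun _ => c') (fun _ => d) (fun _ => d')
    (fun k => (d k = c k ∧ d' k = c' k) ∨ (d k = c' k ∧ d' k = c k)) (fun k _ hk => by
      have h1 := S.generic k _ _ _ _ (hk ()) (hgen k)
      refine ⟨h1, fun _ => ?_⟩
      rcases h1 with ⟨h1, h2⟩ | ⟨h1, h2⟩ <;> rw [h1, h2] <;> abel) (fun _ => by
      simp only [Finset.sum_sub_distrib, Finset.sum_add_distrib, ← Finset.range_eq_Ico]
      rw [h]; abel)
  exact fun k hk => this.2 k (Nat.zero_le k) hk

/-- Generic triples cannot be moved by the diagonal. -/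
theorem eq_of_triple_sum_eq {N : ℕ} (g : G) (c d : Fin 3 → ∀ n, A n)
    (h01 : ∀ n, c 0 n - c 1 n ≠ 0) (h02 : ∀ n, c 0 n - c 2 n ≠ 0) (h12 : ∀ n, c 1 n - c 2 n ≠ 0)
    (f01 : ∀ n, c 0 n - c 1 n ≠ S.flip n) (f02 : ∀ n, c 0 n - c 2 n ≠ S.flip n)
    (h : ∀ a, g + ∑ n ∈ Finset.range N, S.s n (c a n) = ∑ n ∈ Finset.range N, S.s n (d a n)) :
    ∀ k < N, ∀ a, d a k = c a k := by
  have hf : ∀ {n} {x y : A n}, x = y + S.flip n → y = x + S.flip n := by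
    rintro n x y rfl
    rw [add_assoc, S.flip_add_flip, add_zero]
  -- Subtracting equation `b` from equation 0 eliminates `g`. Each digit is then fixed or flipped
  -- against `c b`; combining `b = 1` and `b = 2` excludes the flip.
  have pair : ∀ k, ∀ b : Fin 3, (∀ n, c 0 n - c b n ≠ 0) →
      S.s k (d 0 k) + S.s k (c b k) - S.s k (d b k) - S.s k (c 0 k) ∈ S.V k →
      (d b k = c b k ∧ d 0 k = c 0 k) ∨ d 0 k = c b k + S.flip k := by
    intro k b hb hk
    by_cases hfl : c b k = d 0 k + S.flip k
    · exact Or.inr (hf hfl)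
    · rcases S.generic k _ _ _ _ hk hfl with ⟨-, h2⟩ | ⟨h1, h2⟩
      · exact absurd (by rw [h2, sub_self]) (hb k)
      · exact Or.inl ⟨h1, h2.symm⟩
  have hb : ∀ b : Fin 2, ∀ n, c 0 n - c b.succ n ≠ 0 := by
    intro b
    fin_cases b
    · exact h01
    · exact h02
  have := S.descent (ι := Fin 2) (Nat.zero_le N) (fun _ => 0) (fun _ => S.zero_mem) (fun _ => d 0)
    (fun b => c b.succ) (fun b => d b.succ) (fun _ => c 0)
    (fun k => ∀ a, d a k = c a k) (fun k _ hk => by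
      have h1 := pair k 1 h01 (hk 0)
      have h2 := pair k 2 h02 (hk 1)
      have hall : ∀ a, d a k = c a k := by
        have key : (d 1 k = c 1 k ∧ d 0 k = c 0 k) ∧ (d 2 k = c 2 k ∧ d 0 k = c 0 k) := by
          rcases h1 with h1 | h1 <;> rcases h2 with h2 | h2
          · exact ⟨h1, h2⟩
          · exact absurd (by rw [← h1.2, h2, add_sub_cancel_left]) (f02 k)
          · exact absurd (by rw [← h2.2, h1, add_sub_cancel_left]) (f01 k)
          · exact absurd (sub_eq_zero.2 (add_right_cancel (h1.symm.trans h2))) (h12 k)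
        intro a
        fin_cases a
        · exact key.1.2
        · exact key.1.1
        · exact key.2.1
      refine ⟨hall, fun b => ?_⟩
      rw [hall, hall]; abel) (fun b => by
      simp only [Finset.sum_sub_distrib, Finset.sum_add_distrib, ← Finset.range_eq_Ico, ← h]
      abel)
  exact fun k hk => this.2 k (Nat.zero_le k) hk

end CuttingData

/-! ### General facts on actions -/

namespace MPAction

variable {G : Type*} [AddCommGroup G] {X : Type*} [MeasurableSpace X] {μ : Measure X}

theorem toFun_neg_toFun (T : MPAction G X μ) (g : G) (x : X) : T.toFun (-g) (T.toFun g x) = x := by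
  rw [← T.map_add, neg_add_cancel, T.map_zero]

theorem isErgodic_iff (T : MPAction G X μ) : T.IsErgodic ↔ ∀ B : Set X, MeasurableSet B →
    (∀ g, T.toFun g ⁻¹' B =ᵐ[μ] B) → μ B = 0 ∨ μ Bᶜ = 0 := by
  let _ : VAdd G X := ⟨T.toFun⟩
  constructor
  · intro h B hB hinv
    have h' : ErgodicVAdd G X μ := h
    rcases eventuallyConst_set'.1 (h'.aeconst_of_forall_preimage_vadd_ae_eq hB hinv) with h | h
    · exact Or.inl (ae_eq_empty.1 h)
    · exact Or.inr (ae_eq_univ.1 h)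
  · intro h
    change ErgodicVAdd G X μ
    refine { measure_preimage_vadd := fun g B hB =>
               (T.measurePreserving g).measure_preimage hB.nullMeasurableSet,
             aeconst_of_forall_preimage_vadd_ae_eq := fun hB hinv => ?_ }
    rw [eventuallyConst_set']
    rcases h _ hB hinv with h | h
    · exact Or.inl (ae_eq_empty.2 h)
    · exact Or.inr (ae_eq_univ.2 h)

theorem not_isErgodic_of_disjoint [Countable G] (T : MPAction G X μ) {B₁ B₂ : Set X}
    (hB₁ : MeasurableSet B₁) (h₁ : μ B₁ ≠ 0) (h₂ : μ B₂ ≠ 0)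
    (hdisj : ∀ g, ∀ x ∈ B₁, T.toFun g x ∉ B₂) : ¬ T.IsErgodic := by
  intro h
  rw [isErgodic_iff] at h
  have hinv : ∀ g, T.toFun g ⁻¹' (⋃ k, T.toFun k ⁻¹' B₁) = ⋃ k, T.toFun k ⁻¹' B₁ := by
    intro g
    ext x
    simp only [Set.mem_preimage, Set.mem_iUnion, ← T.map_add]
    exact ⟨fun ⟨k, hk⟩ => ⟨_, hk⟩, fun ⟨k, hk⟩ => ⟨k - g, by rwa [sub_add_cancel]⟩⟩
  rcases h (⋃ g, T.toFun g ⁻¹' B₁)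
    (MeasurableSet.iUnion fun g => (T.measurePreserving g).measurable hB₁)
    (fun g => (hinv g).eventuallyEq) with h | h
  · refine h₁ (measure_mono_null (fun x hx => Set.mem_iUnion.2 ⟨0, ?_⟩) h)
    rwa [Set.mem_preimage, T.map_zero]
  · refine h₂ (measure_mono_null (fun x hx => (?_ : x ∉ _)) h)
    intro hx'
    obtain ⟨g, hg⟩ := Set.mem_iUnion.1 hx'
    refine hdisj (-g) _ hg ?_
    rwa [toFun_neg_toFun]

theorem power_two_isErgodic [SigmaFinite μ] (T : MPAction G X μ) (h : (T.prod T).IsErgodic) :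
    (T.power 2).IsErgodic := by
  rw [isErgodic_iff] at h ⊢
  intro B hB hinv
  have hmp := (measurePreserving_piFinTwo (fun _ : Fin 2 => μ)).symm
  set f := (MeasurableEquiv.piFinTwo (fun _ : Fin 2 => X)).symm with hf
  have hB' : MeasurableSet (f ⁻¹' B) := f.measurable hB
  have hcomm : ∀ g p, f ((T.prod T).toFun g p) = (T.power 2).toFun g (f p) := by
    intro g p
    funext i
    fin_cases i <;> rfl
  have key := h (f ⁻¹' B) hB' fun g => by
    have h1 := hmp.quasiMeasurePreserving.preimage_ae_eq (hinv g)
    have h2 : (T.prod T).toFun g ⁻¹' (f ⁻¹' B) = f ⁻¹' ((T.power 2).toFun g ⁻¹' B) := by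
      ext p
      simp only [Set.mem_preimage, hcomm]
    rwa [h2]
  rwa [hmp.measure_preimage hB.nullMeasurableSet, ← Set.preimage_compl,
    hmp.measure_preimage hB.compl.nullMeasurableSet] at key

/-- Ergodicity of `T × T` passes to `T × R` for `R` isomorphic to `T`. -/
theorem prod_isErgodic_of_isIsomorphic [SigmaFinite μ] {T R : MPAction G X μ}
    (hTR : T.IsIsomorphic R) (h : (T.prod T).IsErgodic) : (T.prod R).IsErgodic := by
  obtain ⟨φ, -, hφ, -, -, -, hint⟩ := hTR
  rw [isErgodic_iff] at h ⊢
  intro B hB hinv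
  have hmp : MeasurePreserving (Prod.map id φ) (μ.prod μ) (μ.prod μ) :=
    (MeasurePreserving.id μ).prod hφ
  have key := h (Prod.map id φ ⁻¹' B) (hmp.measurable hB) fun g => by
    have h1 := hmp.quasiMeasurePreserving.preimage_ae_eq (hinv g)
    refine EventuallyEq.trans ?_ h1
    have h2 : ∀ᵐ p ∂μ.prod μ, φ (T.toFun g p.2) = R.toFun g (φ p.2) :=
      Measure.quasiMeasurePreserving_snd.ae (hint g)
    filter_upwards [h2] with p hp
    have : Prod.map id φ ((T.prod T).toFun g p) = (T.prod R).toFun g (Prod.map id φ p) :=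
      Prod.ext rfl hp
    change (_ ∈ B) = (_ ∈ B)
    rw [this]
  rwa [hmp.measure_preimage hB.nullMeasurableSet, ← Set.preimage_compl,
    hmp.measure_preimage hB.compl.nullMeasurableSet] at key

/-- By Poincaré recurrence, actions of groups with an element of infinite order on finite
measure spaces are conservative. -/
theorem isConservative_of_isFiniteMeasure [IsFiniteMeasure μ] (T : MPAction G X μ) {z : G}
    (hz : ¬ IsOfFinAddOrder z) : T.IsConservative := by
  intro B hB hB0
  obtain ⟨k, hk, h⟩ := (T.measurePreserving z).conservative.exists_gt_measure_inter_ne_zero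
    hB.nullMeasurableSet hB0 0
  have hit : ∀ k x, (T.toFun z)^[k] x = T.toFun (k • z) x := by
    intro k x
    induction k with
    | zero => simp [T.map_zero]
    | succ k ih => rw [Function.iterate_succ_apply', ih, ← T.map_add, succ_nsmul']
  refine ⟨-(k • z), ?_, fun h0 => h (measure_mono_null ?_ h0)⟩
  · intro h0
    exact hz (isOfFinAddOrder_iff_nsmul_eq_zero.2 ⟨k, hk, neg_eq_zero.1 h0⟩)
  · rintro x ⟨hx, hx'⟩
    refine ⟨⟨T.toFun (k • z) x, ?_, T.toFun_neg_toFun _ _⟩, hx⟩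
    rwa [Set.mem_preimage, hit] at hx'

end MPAction

/-! ### Copies of the sequence space inside the envelope -/

namespace Envelope

section Basic

variable {G : Type} [AddCommGroup G] {A : ℕ → Type} [∀ n, AddCommGroup (A n)]
  [∀ n, MeasurableSpace (A n)] {S : CuttingData G A} {P : Measure (∀ n, A n)}
  {X : Type} [MeasurableSpace X] {μ : Measure X} {T : MPAction G X μ} (e : Envelope S.s P T)

/-- A change of finitely many digits is compensated by a group element. -/
theorem j_eq_of_tail_eq (g : G) {c d : ∀ n, A n} {N : ℕ} (h : ∀ n ≥ N, c n = d n) :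
    e.j g c = e.j (g + (∑ n ∈ Finset.range N, S.s n (c n) - ∑ n ∈ Finset.range N, S.s n (d n)))
      d := by
  rw [e.j_eq_iff]
  exact ⟨N, h, by abel⟩

theorem j_eq_of_eq_off (g : G) {c d : ∀ n, A n} {n : ℕ} (h : ∀ k, k ≠ n → c k = d k) :
    e.j g c = e.j (g + (S.s n (c n) - S.s n (d n))) d := by
  rw [e.j_eq_iff]
  refine ⟨n + 1, fun k hk => h k (by omega), ?_⟩
  rw [Finset.sum_range_succ, Finset.sum_range_succ,
    Finset.sum_congr rfl fun k hk => by rw [h k (Finset.mem_range.1 hk).ne]]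
  abel

theorem injective_j (g : G) : Function.Injective (e.j g) := by
  intro c d h
  obtain ⟨N, hN, hsum⟩ := (e.j_eq_iff _ _ _ _).1 h
  exact S.sum_injective N c d hN (add_left_cancel hsum)

theorem exists_sum_eq {g h : G} {c d : ∀ n, A n} (hj : e.j g c = e.j h d) :
    ∃ N, ∀ M ≥ N, (∀ n ≥ M, c n = d n) ∧
      g + ∑ n ∈ Finset.range M, S.s n (c n) = h + ∑ n ∈ Finset.range M, S.s n (d n) := by
  obtain ⟨N, hN, hsum⟩ := (e.j_eq_iff _ _ _ _).1 hj
  refine ⟨N, fun M hM => ⟨fun n hn => hN n (hM.trans hn), ?_⟩⟩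
  rw [← Finset.sum_range_add_sum_Ico _ hM, ← Finset.sum_range_add_sum_Ico _ hM, ← add_assoc,
    ← add_assoc, hsum]
  congr 1
  exact Finset.sum_congr rfl fun k hk => by rw [hN k (Finset.mem_Ico.1 hk).1]

/-- The pieces of the product space. -/
def jPair (g h : G) : (∀ n, A n) × (∀ n, A n) → X × X := Prod.map (e.j g) (e.j h)

theorem measurable_jPair (g h : G) : Measurable (e.jPair g h) :=
  (e.measurable_j g).prodMap (e.measurable_j h)

variable [SigmaFinite μ] [IsProbabilityMeasure P]

theorem map_jPair (g h : G) : (P.prod P).map (e.jPair g h) =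
    (μ.prod μ).restrict (Set.range (e.j g) ×ˢ Set.range (e.j h)) := by
  rw [jPair, ← Measure.map_prod_map _ _ (e.measurable_j g) (e.measurable_j h), e.map_j, e.map_j,
    Measure.prod_restrict]

theorem quasiMeasurePreserving_jPair (g h : G) :
    Measure.QuasiMeasurePreserving (e.jPair g h) (P.prod P) (μ.prod μ) :=
  ⟨e.measurable_jPair g h,
    e.map_jPair g h ▸ Measure.absolutelyContinuous_of_le Measure.restrict_le_self⟩

theorem exists_measure_preimage_jPair_ne_zero [Countable G] {B : Set (X × X)}
    (hB : MeasurableSet B) (hB0 : μ.prod μ B ≠ 0) :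
    ∃ g h, P.prod P (e.jPair g h ⁻¹' B) ≠ 0 := by
  by_contra! hcon
  refine hB0 (measure_mono_null (t := ⋃ p : G × G, B ∩
    (Set.range (e.j p.1) ×ˢ Set.range (e.j p.2))) (fun x hx => ?_)
    (measure_iUnion_null fun p => ?_))
  · obtain ⟨g, c, hg⟩ := e.exists_eq x.1
    obtain ⟨h, d, hh⟩ := e.exists_eq x.2
    exact Set.mem_iUnion.2 ⟨(g, h), hx, ⟨c, hg⟩, ⟨d, hh⟩⟩
  · rw [← Measure.restrict_apply hB, ← e.map_jPair,
      Measure.map_apply (e.measurable_jPair _ _) hB, hcon]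

theorem quasiMeasurePreserving_jTriple :
    Measure.QuasiMeasurePreserving (fun (c : Fin 3 → ∀ n, A n) i => e.j 0 (c i))
      (Measure.pi fun _ => P) (Measure.pi fun _ => μ) := by
  refine ⟨measurable_pi_lambda _ fun i => (e.measurable_j 0).comp (measurable_pi_apply i), ?_⟩
  rw [Measure.pi_map_pi (fun _ => (e.measurable_j 0).aemeasurable)]
  simp only [e.map_j]
  rw [← Measure.restrict_pi_pi]
  exact Measure.absolutelyContinuous_of_le Measure.restrict_le_self

end Basic

end Envelope

/-! ### Measure of generic configurations -/

theorem measureReal_fiber {Z B : Type*} [AddCommGroup Z] [MeasurableSpace Z] [MeasurableAdd Z]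
    [AddCommGroup B] [Finite B] [MeasurableSpace B] [DiscreteMeasurableSpace B]
    {m : Measure Z} [m.IsAddLeftInvariant] [IsProbabilityMeasure m] (f : Z →+ B)
    (hf : Measurable f) (hsurj : Function.Surjective f) (b : B) :
    (Nat.card B : ℝ) * m.real (f ⁻¹' {b}) = 1 := by
  have := card_mul_measureReal_inter_fiber (m := m) f hf (E := Set.univ)
    (fun b => (hsurj b).imp fun z hz => ⟨hz, fun _ => by simp⟩) b
  simpa using this

/-- Union bound: the exceptional sets have total measure at most `2 q`. -/
theorem measureReal_inter_compl_iUnion_pos {Z : Type*} [MeasurableSpace Z] {m : Measure Z}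
    [IsFiniteMeasure m] {E : Set Z} {b : ℕ → Set Z} {q : ℝ}
    (hb : ∀ n, m.real (b n) ≤ q * (1 / 2) ^ n) (hE : q * 2 < m.real E) :
    m (E ∩ (⋃ n, b n)ᶜ) ≠ 0 := by
  have hs : Summable fun n : ℕ => q * (1 / 2 : ℝ) ^ n := summable_geometric_two.mul_left q
  have hU : m (⋃ n, b n) ≤ ENNReal.ofReal (q * 2) := by
    refine (measure_iUnion_le _).trans ?_
    have h0 : ∀ n : ℕ, 0 ≤ q * (1 / 2 : ℝ) ^ n := fun n => measureReal_nonneg.trans (hb n)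
    rw [← tsum_geometric_two, ← tsum_mul_left, ENNReal.ofReal_tsum_of_nonneg h0 hs]
    refine ENNReal.tsum_le_tsum fun n => ?_
    exact (ENNReal.le_ofReal_iff_toReal_le (measure_ne_top _ _) (h0 n)).2 (hb n)
  intro h0
  have h1 : m E ≤ m (⋃ n, b n) := by
    calc m E ≤ m (E ∩ (⋃ n, b n)ᶜ ∪ ⋃ n, b n) := measure_mono fun x hx => by
          by_cases h : x ∈ ⋃ n, b n
          · exact Or.inr h
          · exact Or.inl ⟨hx, h⟩
      _ ≤ m (E ∩ (⋃ n, b n)ᶜ) + m (⋃ n, b n) := measure_union_le _ _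
      _ = _ := by rw [h0, zero_add]
  have hq : 0 ≤ q * 2 := by
    have := measureReal_nonneg.trans (hb 0)
    simp at this; positivity
  exact absurd (ENNReal.toReal_le_of_le_ofReal hq (h1.trans hU)) (not_le.2 hE)

namespace Envelope

variable {G : Type} [AddCommGroup G] {A : ℕ → Type} [∀ n, AddCommGroup (A n)]
  [∀ n, MeasurableSpace (A n)] [∀ n, DiscreteMeasurableSpace (A n)] [∀ n, Finite (A n)]
  {S : CuttingData G A} {P : Measure (∀ n, A n)}
  {X : Type} [MeasurableSpace X] [StandardBorelSpace X] {μ : Measure X} {T : MPAction G X μ}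
  (e : Envelope S.s P T) [SigmaFinite μ] [IsProbabilityMeasure P] [P.IsAddLeftInvariant]

/-! ### Triples -/

/-- The difference of the `n`-th digits of the sequences number `a` and `b`. -/
def digitSub (A : ℕ → Type) [∀ n, AddCommGroup (A n)] (a b : Fin 3) (n : ℕ) :
    (Fin 3 → ∀ n, A n) →+ A n where
  toFun c := c a n - c b n
  map_zero' := by simp
  map_add' c d := by simp [add_sub_add_comm]

theorem measurable_digitSub (a b : Fin 3) (n : ℕ) : Measurable (digitSub A a b n) :=
  ((measurable_pi_apply n).comp (measurable_pi_apply a)).sub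
    ((measurable_pi_apply n).comp (measurable_pi_apply b))

theorem digitSub_surjective {a b : Fin 3} (hab : a ≠ b) (n : ℕ) :
    Function.Surjective (digitSub A a b n) := by
  classical
  intro x
  exact ⟨Pi.single a (Pi.single n x), by simp [digitSub, hab.symm]⟩

/-- The triples that are not generic at the `n`-th digit. -/
def badTriples (S : CuttingData G A) (n : ℕ) : Set (Fin 3 → ∀ n, A n) :=
  (digitSub A 0 1 n ⁻¹' {0} ∪ digitSub A 0 2 n ⁻¹' {0} ∪ digitSub A 1 2 n ⁻¹' {0}) ∪
    (digitSub A 0 1 n ⁻¹' {S.flip n} ∪ digitSub A 0 2 n ⁻¹' {S.flip n})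

/-- The generic triples whose first digit of the first component is of type `x`. -/
def genericTriples (S : CuttingData G A) (x : ZMod 2) : Set (Fin 3 → ∀ n, A n) :=
  {c | S.t 0 (c 0 0) = x} ∩ (⋃ n, badTriples S n)ᶜ

theorem measurableSet_genericTriples (x : ZMod 2) : MeasurableSet (genericTriples S x) := by
  refine MeasurableSet.inter ?_ (MeasurableSet.iUnion fun n => ?_).compl
  · exact ((Measurable.of_discrete (f := S.t 0)).comp
      ((measurable_pi_apply 0).comp (measurable_pi_apply 0))) (measurableSet_singleton x)
  · have h : ∀ a b (y : A n), MeasurableSet (digitSub A a b n ⁻¹' {y}) :=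
      fun a b y => measurable_digitSub a b n (measurableSet_singleton y)
    exact (((h _ _ _).union (h _ _ _)).union (h _ _ _)).union ((h _ _ _).union (h _ _ _))

theorem measure_genericTriples_ne_zero (hcard : ∀ n, 2 ^ (n + 5) ≤ Nat.card (A n)) (x : ZMod 2) :
    (Measure.pi fun _ : Fin 3 => P) (genericTriples S x) ≠ 0 := by
  -- Five bad conditions, each of measure at most `1 / 2 ^ (n + 5)`; their total `5 / 16` is below
  -- the measure `1 / 2` of a type.
  refine measureReal_inter_compl_iUnion_pos (q := 5 / 32) (fun n => ?_) ?_
  · have h : ∀ (a b : Fin 3) (y : A n), a ≠ b →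
        (Measure.pi fun _ : Fin 3 => P).real (digitSub A a b n ⁻¹' {y}) ≤ 1 / 32 * (1 / 2) ^ n := by
      intro a b y hab
      have h1 := measureReal_fiber (m := Measure.pi fun _ : Fin 3 => P) (digitSub A a b n)
        (measurable_digitSub a b n) (digitSub_surjective hab n) y
      have h2 : (2 : ℝ) ^ (n + 5) ≤ Nat.card (A n) := by exact_mod_cast hcard n
      have h3 : (0 : ℝ) < 2 ^ (n + 5) := by positivity
      rw [show (1 : ℝ) / 32 * (1 / 2) ^ n = 1 / 2 ^ (n + 5) by
          rw [pow_add, one_div_pow]; field_simp; norm_num,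
        le_div_iff₀ h3]
      nlinarith [measureReal_nonneg (μ := Measure.pi fun _ : Fin 3 => P)
        (s := digitSub A a b n ⁻¹' {y})]
    have h01 := h 0 1 0 (by decide)
    have h02 := h 0 2 0 (by decide)
    have h12 := h 1 2 0 (by decide)
    have f01 := h 0 1 (S.flip n) (by decide)
    have f02 := h 0 2 (S.flip n) (by decide)
    refine (measureReal_union_le _ _).trans ((add_le_add ((measureReal_union_le _ _).trans
      (add_le_add_left (measureReal_union_le _ _) _)) (measureReal_union_le _ _)).trans ?_)
    linarith
  · let f : (Fin 3 → ∀ n, A n) →+ ZMod 2 :=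
      { toFun := fun c => S.t 0 (c 0 0), map_zero' := by simp, map_add' := by simp }
    have hf : Measurable f := (Measurable.of_discrete (f := S.t 0)).comp
      ((measurable_pi_apply 0).comp (measurable_pi_apply 0))
    have hs : Function.Surjective f := by
      intro y
      obtain ⟨i, hi⟩ := S.t_surjective 0 y
      classical
      exact ⟨Pi.single 0 (Pi.single 0 i), by simp [f, hi]⟩
    have h1 := measureReal_fiber (m := Measure.pi fun _ : Fin 3 => P) f hf hs x
    rw [Nat.card_zmod] at h1
    have h2 : f ⁻¹' {x} = {c | S.t 0 (c 0 0) = x} := rfl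
    rw [h2] at h1
    push_cast at h1
    linarith

/-- This makes the image of the generic triples wandering, and keeps those of type 0 apart from
those of type 1. -/
theorem eq_of_genericTriples {x : ZMod 2} {c d : Fin 3 → ∀ n, A n} (hc : c ∈ genericTriples S x)
    {g : G} (h : (fun i => e.j g (c i)) = fun i => e.j 0 (d i)) : g = 0 ∧ c = d := by
  have hbad : ∀ n, c ∉ badTriples S n := fun n hn => hc.2 (Set.mem_iUnion.2 ⟨n, hn⟩)
  simp only [badTriples, Set.mem_union, not_or, Set.mem_preimage, Set.mem_singleton_iff] at hbad
  choose N hN using fun i => e.exists_sum_eq (congrFun h i)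
  set M := max (N 0) (max (N 1) (N 2)) with hM
  have hNM : ∀ i, N i ≤ M := by
    intro i
    fin_cases i <;> simp [hM]
  have hall := S.eq_of_triple_sum_eq (N := M) g c d (fun n => (hbad n).1.1.1)
    (fun n => (hbad n).1.1.2) (fun n => (hbad n).1.2) (fun n => (hbad n).2.1)
    (fun n => (hbad n).2.2) (fun i => by rw [(hN i M (hNM i)).2, zero_add])
  have hcd : c = d := by
    funext i n
    rcases lt_or_ge n M with hn | hn
    · exact (hall n hn i).symm
    · exact (hN i M (hNM i)).1 n hn
  subst hcd
  refine ⟨?_, rfl⟩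
  exact add_right_cancel (hN 0 M (hNM 0)).2

theorem measurableEmbedding_jTriple :
    MeasurableEmbedding (fun (c : Fin 3 → ∀ n, A n) i => e.j 0 (c i)) := by
  refine Measurable.measurableEmbedding e.quasiMeasurePreserving_jTriple.measurable ?_
  intro c d h
  funext i
  exact e.injective_j 0 (congrFun h i)

theorem measure_image_genericTriples_ne_zero (hcard : ∀ n, 2 ^ (n + 5) ≤ Nat.card (A n))
    (x : ZMod 2) :
    (Measure.pi fun _ : Fin 3 => μ)
      ((fun (c : Fin 3 → ∀ n, A n) i => e.j 0 (c i)) '' genericTriples S x) ≠ 0 := by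
  intro h
  refine measure_genericTriples_ne_zero (P := P) (S := S) hcard x ?_
  exact measure_mono_null (Set.subset_preimage_image _ _)
    (e.quasiMeasurePreserving_jTriple.preimage_null h)

theorem power_three_toFun (g : G) (c : Fin 3 → ∀ n, A n) :
    (T.power 3).toFun g (fun i => e.j 0 (c i)) = fun i => e.j g (c i) := by
  funext i
  change T.toFun g (e.j 0 (c i)) = _
  rw [e.toFun_j, add_zero]

theorem not_isConservative_power_three (e : Envelope S.s P T)
    (hcard : ∀ n, 2 ^ (n + 5) ≤ Nat.card (A n)) :
    ¬ (T.power 3).IsConservative := by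
  intro h
  obtain ⟨g, hg, h⟩ := h _ (e.measurableEmbedding_jTriple.measurableSet_image.2
    (measurableSet_genericTriples (S := S) 0)) (e.measure_image_genericTriples_ne_zero hcard 0)
  obtain ⟨_, ⟨_, ⟨c, hc, rfl⟩, rfl⟩, ⟨d, hd, hcd⟩⟩ := nonempty_of_measure_ne_zero h
  rw [e.power_three_toFun] at hcd
  exact hg (e.eq_of_genericTriples hc hcd.symm).1

theorem not_isErgodic_power_three [Countable G] (e : Envelope S.s P T)
    (hcard : ∀ n, 2 ^ (n + 5) ≤ Nat.card (A n)) :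
    ¬ (T.power 3).IsErgodic := by
  refine (T.power 3).not_isErgodic_of_disjoint (e.measurableEmbedding_jTriple.measurableSet_image.2
    (measurableSet_genericTriples (S := S) 0)) (e.measure_image_genericTriples_ne_zero hcard 0)
    (e.measure_image_genericTriples_ne_zero hcard 1) ?_
  rintro g _ ⟨c, hc, rfl⟩ ⟨d, hd, hcd⟩
  rw [e.power_three_toFun] at hcd
  have h1 := (e.eq_of_genericTriples hc hcd.symm).2
  subst h1
  have h2 : (0 : ZMod 2) = 1 := hc.1.symm.trans hd.1
  exact absurd h2 (by decide)

end Envelope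

/-! ### Pairs of digit sequences -/

section Pairs

variable {A : ℕ → Type} [∀ n, AddCommGroup (A n)]

/-- The pair of the `n`-th digits. -/
def pairDigit (A : ℕ → Type) [∀ n, AddCommGroup (A n)] (n : ℕ) :
    (∀ n, A n) × (∀ n, A n) →+ A n × A n :=
  (Pi.evalAddMonoidHom A n).prodMap (Pi.evalAddMonoidHom A n)

/-- The pair of sequences with prescribed `n`-th digits and zeros elsewhere. -/
def pairSingle (A : ℕ → Type) [∀ n, AddCommGroup (A n)] (n : ℕ) :
    A n × A n →+ (∀ n, A n) × (∀ n, A n) :=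
  (AddMonoidHom.single A n).prodMap (AddMonoidHom.single A n)

theorem pairDigit_pairSingle (n : ℕ) (b : A n × A n) : pairDigit A n (pairSingle A n b) = b :=
  Prod.ext (Pi.single_eq_same n b.1) (Pi.single_eq_same n b.2)

/-- Apply a permutation to the pair of the `n`-th digits. -/
def pairMove (n : ℕ) (β : Equiv.Perm (A n × A n)) (p : (∀ n, A n) × (∀ n, A n)) :
    (∀ n, A n) × (∀ n, A n) :=
  pairSingle A n (β (pairDigit A n p) - pairDigit A n p) + p

theorem pairDigit_pairMove (n : ℕ) (β : Equiv.Perm (A n × A n)) (p : (∀ n, A n) × (∀ n, A n)) :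
    pairDigit A n (pairMove n β p) = β (pairDigit A n p) := by
  rw [pairMove, map_add, pairDigit_pairSingle, sub_add_cancel]

theorem pairSingle_add_fst_of_ne {n k : ℕ} (h : k ≠ n) (b : A n × A n)
    (p : (∀ n, A n) × (∀ n, A n)) : (pairSingle A n b + p).1 k = p.1 k := by
  simp [pairSingle, Pi.single_eq_of_ne h]

theorem pairSingle_add_snd_of_ne {n k : ℕ} (h : k ≠ n) (b : A n × A n)
    (p : (∀ n, A n) × (∀ n, A n)) : (pairSingle A n b + p).2 k = p.2 k := by
  simp [pairSingle, Pi.single_eq_of_ne h]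

theorem digitsPair_pairSingle_add {n N : ℕ} (h : N ≤ n) (b : A n × A n)
    (p : (∀ n, A n) × (∀ n, A n)) : digitsPair N (pairSingle A n b + p) = digitsPair N p :=
  Prod.ext (funext fun k => pairSingle_add_fst_of_ne (k.2.trans_le h).ne b p)
    (funext fun k => pairSingle_add_snd_of_ne (k.2.trans_le h).ne b p)

variable [∀ n, MeasurableSpace (A n)]

theorem measurable_pairDigit (n : ℕ) : Measurable (pairDigit A n) :=
  ((measurable_pi_apply n).comp measurable_fst).prodMk
    ((measurable_pi_apply n).comp measurable_snd)

variable [∀ n, DiscreteMeasurableSpace (A n)] [∀ n, Finite (A n)]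
  {P : Measure (∀ n, A n)} [IsProbabilityMeasure P] [P.IsAddLeftInvariant]

instance : MeasurableAdd ((∀ n, A n) × (∀ n, A n)) where
  measurable_const_add p :=
    (measurable_fst.const_add p.1).prodMk (measurable_snd.const_add p.2)
  measurable_add_const p :=
    (measurable_fst.add_const p.1).prodMk (measurable_snd.add_const p.2)

theorem measurePreserving_pairMove (n : ℕ) (β : Equiv.Perm (A n × A n)) :
    MeasurePreserving (pairMove n β) (P.prod P) (P.prod P) :=
  measurePreserving_permute_fibers (pairDigit A n) (measurable_pairDigit n) (pairSingle A n)
    (pairDigit_pairSingle n) β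

/-- A function of the pair of the `n`-th digits is independent of the earlier digits. -/
theorem card_mul_measureReal_atom_inter {B : Type*} [AddCommGroup B] [Finite B] [MeasurableSpace B]
    [DiscreteMeasurableSpace B] {n N : ℕ} (hN : N ≤ n) (f : A n × A n →+ B)
    (hf : Function.Surjective f) (a : (∀ k : Fin N, A k) × (∀ k : Fin N, A k)) (b : B) :
    (Nat.card B : ℝ) * (P.prod P).real (digitsPair N ⁻¹' {a} ∩ {p | f (pairDigit A n p) = b}) =
      (P.prod P).real (digitsPair N ⁻¹' {a}) := by
  refine card_mul_measureReal_inter_fiber (m := P.prod P) (f.comp (pairDigit A n))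
    ((Measurable.of_discrete (f := f)).comp (measurable_pairDigit n)) (fun b => ?_) b
  obtain ⟨i, hi⟩ := hf b
  refine ⟨pairSingle A n i, ?_, fun p => ?_⟩
  · rw [AddMonoidHom.comp_apply, pairDigit_pairSingle, hi]
  · simp only [Set.mem_preimage, digitsPair_pairSingle_add hN]

end Pairs

namespace Envelope

variable {G : Type} [AddCommGroup G] {A : ℕ → Type} [∀ n, AddCommGroup (A n)]
  [∀ n, MeasurableSpace (A n)] [∀ n, DiscreteMeasurableSpace (A n)] [∀ n, Finite (A n)]
  {S : CuttingData G A} {P : Measure (∀ n, A n)}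
  {X : Type} [MeasurableSpace X] [StandardBorelSpace X] {μ : Measure X} {T : MPAction G X μ}
  (e : Envelope S.s P T) [SigmaFinite μ] [IsProbabilityMeasure P] [P.IsAddLeftInvariant]

theorem prod_toFun_jPair (g a b : G) (p : (∀ n, A n) × (∀ n, A n)) :
    (T.prod T).toFun g (e.jPair a b p) = e.jPair (g + a) (g + b) p :=
  Prod.ext (e.toFun_j g a p.1) (e.toFun_j g b p.2)

theorem prod_inv_toFun_jPair (g a b : G) (p : (∀ n, A n) × (∀ n, A n)) :
    (T.prod T.inv).toFun g (e.jPair a b p) = e.jPair (g + a) (-g + b) p :=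
  Prod.ext (e.toFun_j g a p.1) (e.toFun_j (-g) b p.2)

theorem jPair_pairMove (g h : G) (n : ℕ) (β : Equiv.Perm (A n × A n))
    (p : (∀ n, A n) × (∀ n, A n)) :
    e.jPair g h p = e.jPair (g + (S.s n (p.1 n) - S.s n (β (pairDigit A n p)).1))
      (h + (S.s n (p.2 n) - S.s n (β (pairDigit A n p)).2)) (pairMove n β p) := by
  rw [← pairDigit_pairMove]
  exact Prod.ext
    (e.j_eq_of_eq_off g fun k hk => (pairSingle_add_fst_of_ne hk _ p).symm)
    (e.j_eq_of_eq_off h fun k hk => (pairSingle_add_snd_of_ne hk _ p).symm)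

/-! ### The action `T × T⁻¹` -/

/-- The pairs without flipped digits whose first digits are of type `x`. -/
def genericPairs (S : CuttingData G A) (x : ZMod 2) : Set ((∀ n, A n) × (∀ n, A n)) :=
  {p | S.t 0 (p.1 0) = x ∧ S.t 0 (p.2 0) = x} ∩ (⋃ n, {p | p.2 n - p.1 n = S.flip n})ᶜ

theorem measurableSet_genericPairs (x : ZMod 2) : MeasurableSet (genericPairs S x) := by
  refine MeasurableSet.inter ?_ (MeasurableSet.iUnion fun n => ?_).compl
  · exact measurable_pairDigit 0 (MeasurableSet.of_discrete
      (s := {q : A 0 × A 0 | S.t 0 q.1 = x ∧ S.t 0 q.2 = x}))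
  · exact measurable_pairDigit n (MeasurableSet.of_discrete
      (s := {q : A n × A n | q.2 - q.1 = S.flip n}))

theorem measure_genericPairs_ne_zero (hcard : ∀ n, 2 ^ (n + 5) ≤ Nat.card (A n)) (x : ZMod 2) :
    (P.prod P) (genericPairs S x) ≠ 0 := by
  -- Flipped digits have total measure at most `1 / 16`, below the measure `1 / 4` of a pair of
  -- types.
  refine measureReal_inter_compl_iUnion_pos (q := 1 / 32) (fun n => ?_) ?_
  · have h1 := card_mul_measureReal_atom_inter (P := P) (Nat.zero_le n)
      (AddMonoidHom.snd (A n) (A n) - AddMonoidHom.fst (A n) (A n))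
      (fun y => ⟨(0, y), by simp⟩) default (S.flip n)
    have h0 : digitsPair 0 ⁻¹' {(default : (∀ k : Fin 0, A k) × (∀ k : Fin 0, A k))} =
        (Set.univ : Set ((∀ n, A n) × (∀ n, A n))) :=
      Set.eq_univ_of_forall fun p => Subsingleton.elim _ _
    rw [h0, Set.univ_inter, probReal_univ] at h1
    have h2 : (2 : ℝ) ^ (n + 5) ≤ Nat.card (A n) := by exact_mod_cast hcard n
    have h3 : (0 : ℝ) < 2 ^ (n + 5) := by positivity
    rw [show (1 : ℝ) / 32 * (1 / 2) ^ n = 1 / 2 ^ (n + 5) by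
      rw [pow_add, one_div_pow]; field_simp; norm_num, le_div_iff₀ h3]
    change (Nat.card (A n) : ℝ) * (P.prod P).real {p | p.2 n - p.1 n = S.flip n} = 1 at h1
    nlinarith [measureReal_nonneg (μ := P.prod P) (s := {p | p.2 n - p.1 n = S.flip n})]
  · have h1 := card_mul_measureReal_atom_inter (P := P) (Nat.zero_le 0)
      ((S.t 0).prodMap (S.t 0)) (fun y => by
        obtain ⟨i, hi⟩ := S.t_surjective 0 y.1
        obtain ⟨i', hi'⟩ := S.t_surjective 0 y.2
        exact ⟨(i, i'), Prod.ext hi hi'⟩) default (x, x)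
    have h0 : digitsPair 0 ⁻¹' {(default : (∀ k : Fin 0, A k) × (∀ k : Fin 0, A k))} =
        (Set.univ : Set ((∀ n, A n) × (∀ n, A n))) :=
      Set.eq_univ_of_forall fun p => Subsingleton.elim _ _
    rw [h0, Set.univ_inter, probReal_univ, Nat.card_prod, Nat.card_zmod] at h1
    have h2 : {p : (∀ n, A n) × (∀ n, A n) |
        ((S.t 0).prodMap (S.t 0)) (pairDigit A 0 p) = (x, x)} =
        {p | S.t 0 (p.1 0) = x ∧ S.t 0 (p.2 0) = x} := by
      ext p
      exact Prod.mk_inj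
    rw [h2] at h1
    push_cast at h1
    linarith

theorem measurableEmbedding_jPair (g h : G) : MeasurableEmbedding (e.jPair g h) :=
  (e.measurable_jPair g h).measurableEmbedding
    ((e.injective_j g).prodMap (e.injective_j h))

theorem measure_image_genericPairs_ne_zero (hcard : ∀ n, 2 ^ (n + 5) ≤ Nat.card (A n))
    (x : ZMod 2) : (μ.prod μ) (e.jPair 0 0 '' genericPairs S x) ≠ 0 := by
  intro h
  refine measure_genericPairs_ne_zero (P := P) (S := S) hcard x ?_
  exact measure_mono_null (Set.subset_preimage_image _ _)
    ((e.quasiMeasurePreserving_jPair 0 0).preimage_null h)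

theorem not_isErgodic_prod_inv [Countable G] (e : Envelope S.s P T)
    (hcard : ∀ n, 2 ^ (n + 5) ≤ Nat.card (A n)) : ¬ (T.prod T.inv).IsErgodic := by
  refine (T.prod T.inv).not_isErgodic_of_disjoint
    ((e.measurableEmbedding_jPair 0 0).measurableSet_image.2
    (measurableSet_genericPairs (S := S) 0)) (e.measure_image_genericPairs_ne_zero hcard 0)
    (e.measure_image_genericPairs_ne_zero hcard 1) ?_
  rintro g _ ⟨p, hp, rfl⟩ ⟨q, hq, hpq⟩
  rw [e.prod_inv_toFun_jPair, add_zero, add_zero] at hpq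
  obtain ⟨N, hN⟩ := e.exists_sum_eq (congrArg Prod.fst hpq)
  obtain ⟨N', hN'⟩ := e.exists_sum_eq (congrArg Prod.snd hpq)
  set M := max (max N N') 1 with hM
  have h1 := (hN M (by simp [hM])).2
  have h2 := (hN' M (by simp [hM])).2
  have hgen : ∀ n, p.2 n ≠ p.1 n + S.flip n := fun n hn =>
    hp.2 (Set.mem_iUnion.2 ⟨n, sub_eq_iff_eq_add'.2 hn⟩)
  -- Adding the two coordinate equations cancels `g` against `-g`. The bound `M ≥ 1` makes the
  -- conclusion available at digit 0, whose type separates the two sets.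
  have key := S.swap_of_sum_add_eq p.1 p.2 q.1 q.2 hgen (N := M) (by
    rw [zero_add] at h1 h2
    rw [h1, h2]; abel) 0 (by simp [hM])
  have h01 : (0 : ZMod 2) ≠ 1 := by decide
  rcases key with ⟨h3, -⟩ | ⟨h3, -⟩
  · exact h01 (hp.1.1.symm.trans (h3 ▸ hq.1.1))
  · exact h01 (hp.1.2.symm.trans (h3 ▸ hq.1.1))

/-- Exchanging the `n`-th digits `i`, `i'` of a pair amounts to the antidiagonal move by `s n i - s
n i'`, which is nonzero when `i ≠ i'`. -/
theorem isConservative_prod_inv [Countable G] (e : Envelope S.s P T)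
    (hcard : ∀ n, 2 ^ (n + 5) ≤ Nat.card (A n)) : (T.prod T.inv).IsConservative := by
  intro B hB hB0
  obtain ⟨g, h, hgh⟩ := e.exists_measure_preimage_jPair_ne_zero hB hB0
  set E := e.jPair g h ⁻¹' B with hE
  have hEm : MeasurableSet E := e.measurable_jPair g h hB
  -- From the cylinder `U` one discards two portions of relative size `1 / 8` and the equal digits,
  -- of relative size at most `1 / 32`.
  obtain ⟨n, hn⟩ := exists_digitsPair_diff_lt P hEm hgh (δ := 1 / 8) (by norm_num)
  obtain ⟨a, ha⟩ := hn n le_rfl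
  set U := digitsPair n ⁻¹' {a} with hU
  have hUm : MeasurableSet U := measurable_digitsPair n (.of_discrete (s := {a}))
  set φ := pairMove n (Equiv.prodComm (A n) (A n)) with hφ
  have hφm : MeasurePreserving φ (P.prod P) (P.prod P) := measurePreserving_pairMove n _
  have hφU : φ ⁻¹' U = U := by
    ext p
    simp only [hU, hφ, Set.mem_preimage, pairMove, digitsPair_pairSingle_add le_rfl]
  set W := {p : (∀ n, A n) × (∀ n, A n) | p ∈ E ∧ φ p ∈ E ∧ p.1 n ≠ p.2 n} with hW
  have hW0 : P.prod P W ≠ 0 := by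
    intro hW0
    have h1 := card_mul_measureReal_atom_inter (P := P) (le_refl n)
      (AddMonoidHom.snd (A n) (A n) - AddMonoidHom.fst (A n) (A n))
      (fun y => ⟨(0, y), by simp⟩) a 0
    have h2 : (32 : ℝ) ≤ Nat.card (A n) := by
      have h3 := hcard n
      have h4 : 2 ^ 5 ≤ 2 ^ (n + 5) := Nat.pow_le_pow_right (by norm_num) (by omega)
      have : 32 ≤ Nat.card (A n) := by omega
      exact_mod_cast this
    set Eq := {p : (∀ n, A n) × (∀ n, A n) |
      (AddMonoidHom.snd (A n) (A n) - AddMonoidHom.fst (A n) (A n)) (pairDigit A n p) = 0}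
    have hsub : U ⊆ W ∪ (U ∩ Eq ∪ (U \ E ∪ φ ⁻¹' (U \ E))) := by
      intro p hp
      by_cases h3 : p ∈ E
      · by_cases h4 : φ p ∈ E
        · by_cases h5 : p.1 n = p.2 n
          · exact Or.inr (Or.inl ⟨hp, sub_eq_zero.2 h5.symm⟩)
          · exact Or.inl ⟨h3, h4, h5⟩
        · exact Or.inr (Or.inr (Or.inr ⟨by rw [← hφU] at hp; exact hp, h4⟩))
      · exact Or.inr (Or.inr (Or.inl ⟨hp, h3⟩))
    have h3 : (P.prod P).real U ≤ (P.prod P).real W + ((P.prod P).real (U ∩ Eq) +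
        ((P.prod P).real (U \ E) + (P.prod P).real (φ ⁻¹' (U \ E)))) :=
      (measureReal_mono hsub).trans ((measureReal_union_le _ _).trans (add_le_add_right
        ((measureReal_union_le _ _).trans (add_le_add_right (measureReal_union_le _ _) _)) _))
    have h4 : (P.prod P).real W = 0 := by simp [Measure.real, hW0]
    have h5 : (P.prod P).real (φ ⁻¹' (U \ E)) = (P.prod P).real (U \ E) := by
      simp only [Measure.real]
      rw [hφm.measure_preimage (hUm.diff hEm).nullMeasurableSet]
    rw [h4, h5] at h3
    nlinarith [measureReal_nonneg (μ := P.prod P) (s := U ∩ Eq),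
      measureReal_nonneg (μ := P.prod P) (s := U \ E)]
  -- The group element depends only on the pair of digits, so one of the finitely many pairs must
  -- carry positive measure.
  have hpiece : ∃ q : A n × A n, q.1 ≠ q.2 ∧ P.prod P (W ∩ {p | pairDigit A n p = q}) ≠ 0 := by
    by_contra! hcon
    refine hW0 (measure_mono_null (t := ⋃ q : {q : A n × A n // q.1 ≠ q.2},
      W ∩ {p | pairDigit A n p = q}) (fun p hp => ?_)
      (measure_iUnion_null fun q => hcon q q.2))
    exact Set.mem_iUnion.2 ⟨⟨pairDigit A n p, hp.2.2⟩, hp, rfl⟩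
  obtain ⟨q, hq, hq0⟩ := hpiece
  refine ⟨S.s n q.1 - S.s n q.2, fun h0 => hq (S.s_injective n (sub_eq_zero.1 h0)), fun h0 => ?_⟩
  refine hq0 (measure_mono_null ?_ ((e.quasiMeasurePreserving_jPair g h).preimage_null h0))
  rintro p ⟨⟨hp1, hp2, -⟩, rfl⟩
  refine ⟨⟨e.jPair g h (φ p), hp2, ?_⟩, hp1⟩
  rw [e.prod_inv_toFun_jPair, e.jPair_pairMove g h n (Equiv.prodComm (A n) (A n)) p]
  congr 1
  · exact add_comm _ _
  · rw [add_comm, neg_sub]; rfl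

/-! ### The action `T × T` -/

/-- Translating by the difference of two words, extended by 0, carries one cylinder onto the other.
On the cylinder this changes the group coordinates by a constant. -/
theorem exists_jPair_transport (g h : G) {N : ℕ}
    (a a' : (∀ k : Fin N, A k) × (∀ k : Fin N, A k)) (B : Set (X × X)) :
    ∃ g' h', (P.prod P) (digitsPair N ⁻¹' {a} ∩ e.jPair g' h' ⁻¹' B) =
      (P.prod P) (digitsPair N ⁻¹' {a'} ∩ e.jPair g h ⁻¹' B) ∧
      (P.prod P) (digitsPair N ⁻¹' {a}) = (P.prod P) (digitsPair N ⁻¹' {a'}) := by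
  let ext : (∀ k : Fin N, A k) → ∀ n, A n := fun w n => if hn : n < N then w ⟨n, hn⟩ else 0
  have ext_lt : ∀ w n (hn : n < N), ext w n = w ⟨n, hn⟩ := fun w n hn => dif_pos hn
  have ext_ge : ∀ w n, N ≤ n → ext w n = 0 := fun w n hn => dif_neg (not_lt.2 hn)
  let ζ : (∀ n, A n) × (∀ n, A n) := (ext a'.1 - ext a.1, ext a'.2 - ext a.2)
  have hdig : ∀ (w w' : ∀ k : Fin N, A k) (c : ∀ n, A n),
      digits N (ext w' - ext w + c) = w' ↔ digits N c = w := by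
    intro w w' c
    simp only [funext_iff, digits]
    refine forall_congr' fun k => ?_
    simp only [Pi.add_apply, Pi.sub_apply, ext_lt _ _ k.2]
    rw [sub_add_eq_add_sub, sub_eq_iff_eq_add, add_right_inj]
  have hj : ∀ (w w' : ∀ k : Fin N, A k) (c : ∀ n, A n) (g : G), digits N c = w →
      e.j g (ext w' - ext w + c) = e.j (g + (∑ n ∈ Finset.range N, S.s n (ext w' n) -
        ∑ n ∈ Finset.range N, S.s n (ext w n))) c := by
    intro w w' c g hc
    rw [e.j_eq_of_tail_eq g (d := c) (N := N) fun n hn => by simp [ext_ge _ n hn]]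
    have h1 : ∀ n ∈ Finset.range N, c n = ext w n := fun n hn => by
      rw [ext_lt _ _ (Finset.mem_range.1 hn), ← hc]; rfl
    congr 3
    · refine Finset.sum_congr rfl fun n hn => ?_
      simp [h1 n hn]
    · exact Finset.sum_congr rfl fun n hn => by rw [h1 n hn]
  have hmem : ∀ p, ζ + p ∈ digitsPair N ⁻¹' {a'} ↔ p ∈ digitsPair N ⁻¹' {a} := by
    intro p
    simp only [Set.mem_preimage, Set.mem_singleton_iff, digitsPair, Prod.ext_iff]
    exact and_congr (hdig _ _ _) (hdig _ _ _)
  let κ : (∀ k : Fin N, A k) → (∀ k : Fin N, A k) → G := fun w w' =>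
    ∑ n ∈ Finset.range N, S.s n (ext w' n) - ∑ n ∈ Finset.range N, S.s n (ext w n)
  refine ⟨g + κ a.1 a'.1, h + κ a.2 a'.2, ?_, ?_⟩
  · rw [← measure_preimage_add (P.prod P) ζ (digitsPair N ⁻¹' {a'} ∩ _)]
    refine congrArg (P.prod P) (Eq.symm ?_)
    ext p
    rw [Set.mem_preimage, Set.mem_inter_iff, Set.mem_inter_iff, hmem]
    refine and_congr_right fun hp => ?_
    have h1 : e.jPair g h (ζ + p) = e.jPair (g + κ a.1 a'.1) (h + κ a.2 a'.2) p := Prod.ext (hj a.1 a'.1 p.1 g (congrArg Prod.fst hp))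
      (hj a.2 a'.2 p.2 h (congrArg Prod.snd hp))
    exact iff_of_eq (congrArg (· ∈ B) h1)
  · rw [← measure_preimage_add (P.prod P) ζ (digitsPair N ⁻¹' {a'})]
    refine congrArg (P.prod P) ?_
    ext p
    exact (hmem p).symm

/-- Otherwise `B` nearly fills a cylinder `U` in the piece `(g₁, h₁)` and, after transport, nearly
misses the same `U` in a piece `(g₃, h₃)`. The flipped exchange carries the first piece to a
diagonal translate of the second on a quarter of `U`, which contradicts invariance. -/
theorem isErgodic_prod [Countable G] (e : Envelope S.s P T) : (T.prod T).IsErgodic := by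
  rw [MPAction.isErgodic_iff]
  intro B hB hinv
  by_contra! hcon
  obtain ⟨g₁, h₁, h1⟩ := e.exists_measure_preimage_jPair_ne_zero hB hcon.1
  obtain ⟨g₂, h₂, h2⟩ := e.exists_measure_preimage_jPair_ne_zero hB.compl hcon.2
  have hm : ∀ g h, MeasurableSet (e.jPair g h ⁻¹' B) := fun g h => e.measurable_jPair g h hB
  -- The two errors of `1 / 16` must stay below the quarter of `U` on which the exchange acts.
  obtain ⟨N₁, hN₁⟩ := exists_digitsPair_diff_lt P (hm g₁ h₁) h1 (δ := 1 / 16) (by norm_num)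
  obtain ⟨N₂, hN₂⟩ := exists_digitsPair_diff_lt P (e.measurable_jPair g₂ h₂ hB.compl) h2
    (δ := 1 / 16) (by norm_num)
  set N := max N₁ N₂
  obtain ⟨a, ha⟩ := hN₁ N (le_max_left _ _)
  obtain ⟨a', ha'⟩ := hN₂ N (le_max_right _ _)
  obtain ⟨g₃, h₃, h3, h4⟩ := e.exists_jPair_transport g₂ h₂ a a' B
  set U := digitsPair N ⁻¹' {a} with hU
  have hUm : MeasurableSet U := measurable_digitsPair N (.of_discrete (s := {a}))
  have hb : (P.prod P).real (U ∩ e.jPair g₃ h₃ ⁻¹' B) < 1 / 16 * (P.prod P).real U := by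
    have h5 : digitsPair N ⁻¹' {a'} \ e.jPair g₂ h₂ ⁻¹' Bᶜ =
        digitsPair N ⁻¹' {a'} ∩ e.jPair g₂ h₂ ⁻¹' B := by
      rw [Set.preimage_compl, Set.sdiff_compl]
    rw [h5] at ha'
    simp only [Measure.real] at ha' ⊢
    rwa [h3, h4]
  -- The prescribed shift is the discrepancy between the off-diagonal positions of the two pieces;
  -- `n ≥ N` leaves the cylinder untouched.
  obtain ⟨n, hn, hshift⟩ := (frequently_atTop.1 (S.flip_shift ((g₁ - h₁) - (g₃ - h₃)))) N
  let β : Equiv.Perm (A n × A n) :=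
    (Equiv.prodComm (A n) (A n)).trans
      ((Equiv.addRight (S.flip n)).prodCongr (Equiv.addRight (S.flip n)))
  set φ := pairMove n β with hφ
  have hφm : MeasurePreserving φ (P.prod P) (P.prod P) := measurePreserving_pairMove n _
  have hφU : φ ⁻¹' U = U := by
    ext p
    simp only [hU, hφ, Set.mem_preimage, pairMove, digitsPair_pairSingle_add hn]
  -- The diagonal element `k` varies with the point, so failures of invariance are collected over
  -- all of the countable group.
  set Nul : Set ((∀ n, A n) × (∀ n, A n)) :=
    ⋃ k : G, {p | ¬ (e.jPair (k + g₃) (k + h₃) p ∈ B ↔ e.jPair g₃ h₃ p ∈ B)} with hNul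
  have hNul0 : P.prod P Nul = 0 := by
    refine measure_iUnion_null fun k => ?_
    have h5 : ∀ᵐ x ∂μ.prod μ, ((T.prod T).toFun k x ∈ B ↔ x ∈ B) := by
      filter_upwards [hinv k] with x hx
      exact hx.to_iff
    have h6 := (e.quasiMeasurePreserving_jPair g₃ h₃).ae h5
    simp only [e.prod_toFun_jPair] at h6
    exact h6
  have hcardD := card_mul_measureReal_atom_inter (P := P) hn
    ((S.t n).prodMap (S.t n)) (fun y => by
      obtain ⟨i, hi⟩ := S.t_surjective n y.1
      obtain ⟨i', hi'⟩ := S.t_surjective n y.2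
      exact ⟨(i, i'), Prod.ext hi hi'⟩) a (0, 1)
  rw [Nat.card_prod, Nat.card_zmod] at hcardD
  push_cast at hcardD
  set Dom := {p : (∀ n, A n) × (∀ n, A n) |
    ((S.t n).prodMap (S.t n)) (pairDigit A n p) = (0, 1)} with hDom
  have hsub : U ∩ Dom ⊆ U \ e.jPair g₁ h₁ ⁻¹' B ∪
      (φ ⁻¹' (U ∩ e.jPair g₃ h₃ ⁻¹' B) ∪ φ ⁻¹' Nul) := by
    rintro p ⟨hpU, hpD⟩
    by_cases hpB : e.jPair g₁ h₁ p ∈ B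
    · right
      by_cases hpN : φ p ∈ Nul
      · exact Or.inr hpN
      · left
        refine ⟨by rw [← hφU] at hpU; exact hpU, ?_⟩
        have hs := hshift (p.1 n) (p.2 n) (congrArg Prod.fst hpD) (congrArg Prod.snd hpD)
        rw [e.jPair_pairMove g₁ h₁ n β p] at hpB
        set k := g₁ + (S.s n (p.1 n) - S.s n (p.2 n + S.flip n)) - g₃ with hk
        have hk1 : g₁ + (S.s n (p.1 n) - S.s n (β (pairDigit A n p)).1) = k + g₃ := by
          rw [hk, sub_add_cancel]; rfl
        have hk2 : h₁ + (S.s n (p.2 n) - S.s n (β (pairDigit A n p)).2) = k + h₃ := by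
          change h₁ + (S.s n (p.2 n) - S.s n (p.1 n + S.flip n)) = k + h₃
          rw [hk]
          have h7 : S.s n (p.2 n + S.flip n) = S.s n (p.1 n + S.flip n) +
            (S.s n (p.1 n) - S.s n (p.2 n) + (g₁ - h₁ - (g₃ - h₃))) := by rw [← hs]; abel
          rw [h7]; abel
        rw [hk1, hk2] at hpB
        by_contra hp3
        exact hpN (Set.mem_iUnion.2 ⟨k, fun hiff => hp3 (hiff.1 hpB)⟩)
    · exact Or.inl ⟨hpU, hpB⟩
  have hle : (P.prod P).real (U ∩ Dom) ≤ (P.prod P).real (U \ e.jPair g₁ h₁ ⁻¹' B) +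
      ((P.prod P).real (φ ⁻¹' (U ∩ e.jPair g₃ h₃ ⁻¹' B)) + (P.prod P).real (φ ⁻¹' Nul)) :=
    (measureReal_mono hsub).trans ((measureReal_union_le _ _).trans (add_le_add_right
      (measureReal_union_le _ _) _))
  have h5 : (P.prod P).real (φ ⁻¹' (U ∩ e.jPair g₃ h₃ ⁻¹' B)) =
      (P.prod P).real (U ∩ e.jPair g₃ h₃ ⁻¹' B) := by
    simp only [Measure.real]
    rw [hφm.measure_preimage (hUm.inter (hm _ _)).nullMeasurableSet]
  have h6 : (P.prod P).real (φ ⁻¹' Nul) = 0 := by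
    simp [Measure.real, hφm.quasiMeasurePreserving.preimage_null hNul0]
  rw [h5, h6] at hle
  nlinarith [measureReal_nonneg (μ := P.prod P) (s := U \ e.jPair g₁ h₁ ⁻¹' B)]

end Envelope

theorem digits_surjective {A : ℕ → Type} [∀ n, AddCommGroup (A n)] (n : ℕ) :
    Function.Surjective (digits (A := A) n) := fun w =>
  ⟨fun k => if hk : k < n then w ⟨k, hk⟩ else 0, funext fun k => dif_pos k.2⟩

namespace Envelope

variable {G : Type} [AddCommGroup G] {A : ℕ → Type} [∀ n, AddCommGroup (A n)]
  [∀ n, MeasurableSpace (A n)] [∀ n, DiscreteMeasurableSpace (A n)] [∀ n, Finite (A n)]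
  {S : CuttingData G A} {P : Measure (∀ n, A n)}
  {X : Type} [MeasurableSpace X] [StandardBorelSpace X] {μ : Measure X} {T : MPAction G X μ}
  (e : Envelope S.s P T)

/-! ### The towers -/

/-- The base of the `n`-th tower. -/
def base (n : ℕ) : Set X :=
  e.j (-∑ k ∈ Finset.range n, S.s k 0) '' {c | digits n c = digits n 0}

theorem measurableEmbedding_j (g : G) : MeasurableEmbedding (e.j g) :=
  (e.measurable_j g).measurableEmbedding (e.injective_j g)

theorem measure_image_j (g : G) {E : Set (∀ n, A n)} (hE : MeasurableSet E) :
    μ (e.j g '' E) = P E := by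
  have hm := (e.measurableEmbedding_j g).measurableSet_image.2 hE
  have h : (P.map (e.j g)) (e.j g '' E) = (μ.restrict (Set.range (e.j g))) (e.j g '' E) := by
    rw [e.map_j]
  rw [Measure.map_apply (e.measurable_j g) hm, Set.preimage_image_eq _ (e.injective_j g),
    Measure.restrict_apply hm, Set.inter_eq_left.2 (Set.image_subset_range _ _)] at h
  exact h.symm

theorem toFun_image_base (h : G) (n : ℕ) : T.toFun h '' e.base n =
    e.j (h + -∑ k ∈ Finset.range n, S.s k 0) '' {c | digits n c = digits n 0} := by
  rw [base, Set.image_image]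
  simp only [e.toFun_j]

/-- The shift by `-∑ s k 0` in `base` is what makes every cylinder of every copy a translate of the
base by this element. -/
theorem toFun_image_base_eq_cylinder (g : G) (n : ℕ) (w : ∀ k, A k) :
    T.toFun (g + ∑ k ∈ Finset.range n, S.s k (w k)) '' e.base n =
      e.j g '' (digits n ⁻¹' {digits n w}) := by
  classical
  have key : ∀ (c d v : ∀ k, A k) (a b : G), digits n c = digits n v → (∀ k ≥ n, c k = d k) →
      a + ∑ k ∈ Finset.range n, S.s k (v k) = b + ∑ k ∈ Finset.range n, S.s k (d k) →
      e.j a c = e.j b d := by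
    intro c d v a b hc hcd hs
    rw [e.j_eq_iff]
    refine ⟨n, hcd, hs ▸ ?_⟩
    congr 1
    exact Finset.sum_congr rfl fun k hk => by rw [digits_eq_iff.1 hc k (Finset.mem_range.1 hk)]
  let graft : (∀ k, A k) → (∀ k, A k) → ∀ k, A k := fun v c k => if k < n then v k else c k
  have hgraft : ∀ v c, digits n (graft v c) = digits n v := fun v c =>
    digits_eq_iff.2 fun k hk => if_pos hk
  have hsum : ∀ v c, ∑ k ∈ Finset.range n, S.s k (graft v c k) =
      ∑ k ∈ Finset.range n, S.s k (v k) := fun v c => Finset.sum_congr rfl fun k hk => by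
    rw [digits_eq_iff.1 (hgraft v c) k (Finset.mem_range.1 hk)]
  have htail : ∀ v c, ∀ k ≥ n, graft v c k = c k := fun v c k hk => if_neg (not_lt.2 hk)
  rw [toFun_image_base]
  ext x
  constructor
  · rintro ⟨c, hc, rfl⟩
    refine ⟨graft w c, hgraft w c, ?_⟩
    refine (key c _ 0 _ _ hc (fun k hk => (htail w c k hk).symm) ?_).symm
    rw [hsum]
    simp
  · rintro ⟨c, hc, rfl⟩
    refine ⟨graft 0 c, hgraft 0 c, ?_⟩
    refine (key c _ w _ _ hc (fun k hk => (htail 0 c k hk).symm) ?_).symm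
    rw [hsum]
    simp

/-- Differences of elements of `F n` lie in `V n`, so later digits cannot compensate them. -/
theorem disjoint_levels {n : ℕ} {g h : G} (hg : g ∈ S.F n) (hh : h ∈ S.F n) (hne : g ≠ h) :
    Disjoint (T.toFun g '' e.base n) (T.toFun h '' e.base n) := by
  rw [toFun_image_base, toFun_image_base, Set.disjoint_left]
  rintro _ ⟨c, hc, rfl⟩ ⟨d, hd, hcd⟩
  obtain ⟨N, hN⟩ := e.exists_sum_eq hcd.symm
  have h1 := (hN (max N n) (le_max_left _ _)).2
  have hsum : ∀ v : ∀ k, A k, digits n v = digits n 0 → ∀ a : G,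
      a + -∑ k ∈ Finset.range n, S.s k 0 + ∑ k ∈ Finset.range (max N n), S.s k (v k) =
      a + ∑ k ∈ Finset.Ico n (max N n), S.s k (v k) := by
    intro v hv a
    have h2 : ∑ k ∈ Finset.range n, S.s k (v k) = ∑ k ∈ Finset.range n, S.s k 0 :=
      Finset.sum_congr rfl fun k hk => by
        rw [digits_eq_iff.1 hv k (Finset.mem_range.1 hk)]; rfl
    rw [← Finset.sum_range_add_sum_Ico _ (le_max_right N n), h2]
    abel
  rw [hsum c hc, hsum d hd] at h1
  exact hne (S.eq_of_add_sum_eq (le_max_right N n) (S.sub_mem n g hg h hh) c d h1).1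

/-- The set `B` is approximated by unions of levels of the towers. -/
def IsApproximated (B : Set X) : Prop :=
  ∀ ε : ENNReal, ε ≠ 0 → ∀ᶠ n in atTop, ∃ D ⊆ S.F n,
    μ (symmDiff B (⋃ g ∈ D, T.toFun g '' e.base n)) ≤ ε

theorem isApproximated_empty : e.IsApproximated ∅ := fun ε _ =>
  Eventually.of_forall fun n => ⟨∅, Finset.empty_subset _, by simp⟩

theorem IsApproximated.union {B₁ B₂ : Set X} (h₁ : e.IsApproximated B₁)
    (h₂ : e.IsApproximated B₂) : e.IsApproximated (B₁ ∪ B₂) := by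
  classical
  intro ε hε
  have hε2 : ε / 2 ≠ 0 := by simpa using hε
  filter_upwards [h₁ _ hε2, h₂ _ hε2] with n ⟨D₁, hD₁, hμ₁⟩ ⟨D₂, hD₂, hμ₂⟩
  refine ⟨D₁ ∪ D₂, Finset.union_subset hD₁ hD₂, ?_⟩
  rw [Finset.set_biUnion_union]
  refine (measure_mono (t := symmDiff B₁ (⋃ g ∈ D₁, T.toFun g '' e.base n) ∪
    symmDiff B₂ (⋃ g ∈ D₂, T.toFun g '' e.base n)) ?_).trans
    ((measure_union_le _ _).trans ((add_le_add hμ₁ hμ₂).trans_eq (ENNReal.add_halves ε)))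
  intro x
  simp only [Set.mem_symmDiff, Set.mem_union]
  tauto

theorem isApproximated_of_forall_exists {B : Set X}
    (h : ∀ ε : ENNReal, ε ≠ 0 → ∃ B', e.IsApproximated B' ∧ μ (symmDiff B B') ≤ ε) :
    e.IsApproximated B := by
  intro ε hε
  have hε2 : ε / 2 ≠ 0 := by simpa using hε
  obtain ⟨B', hB', hBB'⟩ := h _ hε2
  filter_upwards [hB' _ hε2] with n ⟨D, hD, hμ⟩
  exact ⟨D, hD, (measure_symmDiff_le _ _ _).trans
    ((add_le_add hBB' hμ).trans_eq (ENNReal.add_halves ε))⟩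

/-- Cylinders approximate `E`, and by `exhaust` those of the copy `j g` are levels of the `n`-th
tower for large `n`. -/
theorem isApproximated_image_j [IsProbabilityMeasure P] (g : G) {E : Set (∀ n, A n)}
    (hE : MeasurableSet E) : e.IsApproximated (e.j g '' E) := by
  classical
  intro ε hε
  -- The minimum with 1 covers `ε = ⊤`, whose real value would be 0.
  have hδ : 0 < (min ε 1).toReal :=
    ENNReal.toReal_pos (by simp [hε]) (by simp)
  obtain ⟨N, hN⟩ := exists_digits_symmDiff_lt P hE hδ
  filter_upwards [eventually_ge_atTop N, S.exhaust g] with n hn hex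
  obtain ⟨U, hU⟩ := hN n hn
  choose ext hext using digits_surjective (A := A) n
  have := Fintype.ofFinite (∀ k : Fin n, A k)
  refine ⟨U.toFinset.image fun w => g + ∑ k ∈ Finset.range n, S.s k (ext w k), ?_, ?_⟩
  · intro x hx
    obtain ⟨w, -, rfl⟩ := Finset.mem_image.1 hx
    exact hex _
  · have hun : ⋃ h ∈ U.toFinset.image fun w => g + ∑ k ∈ Finset.range n, S.s k (ext w k),
        T.toFun h '' e.base n = e.j g '' (digits n ⁻¹' U) := by
      rw [Finset.set_biUnion_finset_image]
      simp only [e.toFun_image_base_eq_cylinder, hext, Set.mem_toFinset]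
      rw [← Set.image_iUnion₂, ← Set.preimage_iUnion₂, Set.biUnion_of_singleton]
    rw [hun, ← Set.image_symmDiff (e.injective_j g), e.measure_image_j g
      (hE.symmDiff (measurable_digits n .of_discrete))]
    refine le_trans ?_ (min_le_left ε 1)
    exact (ENNReal.toReal_le_toReal (measure_ne_top _ _) (by simp)).1 hU.le

/-- Finite measure allows all but `ε` of `B` to be covered by finitely many copies. -/
theorem isApproximated_of_measure_lt_top [Countable G] [IsProbabilityMeasure P] {B : Set X}
    (hB : MeasurableSet B) (hB' : μ B < ⊤) : e.IsApproximated B := by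
  obtain ⟨f, hf⟩ := exists_surjective_nat G
  let C : ℕ → Set X := fun n => ⋃ k < n, B ∩ Set.range (e.j (f k))
  have hC_succ : ∀ n, C (n + 1) = C n ∪ B ∩ Set.range (e.j (f n)) := fun n =>
    Set.biUnion_lt_succ _ _
  have hpiece : ∀ g, e.IsApproximated (B ∩ Set.range (e.j g)) := by
    intro g
    rw [← Set.image_preimage_eq_inter_range]
    exact e.isApproximated_image_j g (e.measurable_j g hB)
  have hC : ∀ n, e.IsApproximated (C n) := by
    intro n
    induction n with
    | zero => simpa [C] using e.isApproximated_empty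
    | succ n ih =>
      rw [hC_succ]
      exact ih.union e (hpiece _)
  have hCm : ∀ n, MeasurableSet (C n) := fun n =>
    MeasurableSet.biUnion (Set.to_countable _) fun k _ =>
      hB.inter (e.measurableEmbedding_j _).measurableSet_range
  have hlim : Tendsto (fun n => μ (B \ C n)) atTop (𝓝 0) := by
    have h0 : ⋂ n, B \ C n = ∅ := by
      refine Set.eq_empty_of_forall_notMem fun x hx => ?_
      rw [Set.mem_iInter] at hx
      obtain ⟨g, c, hc⟩ := e.exists_eq x
      obtain ⟨k, rfl⟩ := hf g
      exact (hx (k + 1)).2 (Set.mem_biUnion (Nat.lt_succ_self k) ⟨(hx 0).1, c, hc⟩)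
    rw [← measure_empty (μ := μ), ← h0]
    refine tendsto_measure_iInter_atTop (fun n => (hB.diff (hCm n)).nullMeasurableSet) ?_
      ⟨0, ((measure_mono Set.sdiff_subset).trans_lt hB').ne⟩
    exact antitone_nat_of_succ_le fun n => Set.sdiff_subset_sdiff_right (by
      rw [hC_succ]; exact Set.subset_union_left)
  refine e.isApproximated_of_forall_exists fun ε hε => ?_
  obtain ⟨n, hn⟩ := (ENNReal.tendsto_nhds_zero.1 hlim ε (pos_iff_ne_zero.2 hε)).exists
  refine ⟨C n, hC n, ?_⟩
  have hsub : C n ⊆ B := Set.iUnion₂_subset fun k _ => Set.inter_subset_left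
  rwa [symmDiff_of_ge (a := B) (b := C n) hsub]

theorem isFunnyRankOneAlong [Countable G] [IsProbabilityMeasure P] (e : Envelope S.s P T) :
    T.IsFunnyRankOneAlong S.F := by
  refine ⟨e.base, fun n => ?_, fun n g hg h hh hne => e.disjoint_levels hg hh hne,
    fun B hB hB' => ?_⟩
  · have hm : MeasurableSet {c : ∀ n, A n | digits n c = digits n 0} :=
      measurable_digits n (.of_discrete (s := {digits n 0}))
    refine ⟨(e.measurableEmbedding_j _).measurableSet_image.2 hm, ?_⟩
    rw [base, e.measure_image_j _ hm]
    exact measure_lt_top _ _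
  -- Taking a best union of levels for each `n` gives one sequence that works for every `ε`.
  · have hmin := fun n => Finset.exists_min_image (S.F n).powerset
      (fun D => μ (symmDiff B (⋃ g ∈ D, T.toFun g '' e.base n)))
      ⟨∅, Finset.empty_mem_powerset _⟩
    choose D hD hDmin using hmin
    refine ⟨D, fun n => Finset.mem_powerset.1 (hD n), ENNReal.tendsto_nhds_zero.2 fun ε hε => ?_⟩
    filter_upwards [e.isApproximated_of_measure_lt_top hB hB' ε hε.ne'] with n ⟨D', hD', hμ⟩
    exact (hDmin n D' (Finset.mem_powerset.2 hD')).trans hμ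

end Envelope

/-! ### Assembly of the action -/

theorem exists_action_of_cofinal {G : Type} [AddCommGroup G] [Countable G] {z : G}
    (hz : ¬ IsOfFinAddOrder z) (𝓕 : Set (Finset G)) (h𝓕 : ∀ E : Finset G, ∃ F ∈ 𝓕, E ⊆ F) :
    ∃ (X : Type) (_ : MeasurableSpace X) (_ : StandardBorelSpace X)
      (μ : Measure X) (_ : SigmaFinite μ) (T : MPAction G X μ),
      μ Set.univ = ⊤ ∧
      (∃ F : ℕ → Finset G, (∀ n, F n ∈ 𝓕) ∧ T.IsFunnyRankOneAlong F) ∧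
      T.HasErgodicIndex 2 ∧
      (T.prod T.inv).IsConservative ∧
      ¬ (T.prod T.inv).IsErgodic ∧
      ¬ (T.power 3).IsConservative ∧
      ¬ T.IsIsomorphic T.inv := by
  let _ : MeasurableSpace G := ⊤
  have : DiscreteMeasurableSpace G := ⟨fun _ => trivial⟩
  obtain ⟨S, hS⟩ := exists_cuttingData hz 𝓕 h𝓕
  obtain ⟨P, _, _⟩ := exists_invariant_probability Alphabet
  obtain ⟨X, _, _, μ, _, T, ⟨e⟩⟩ := exists_envelope S.s P S.sum_injective
  have hcard : ∀ n, 2 ^ (n + 5) ≤ Nat.card (Alphabet n) := by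
    intro n
    rw [Nat.card_prod, Nat.card_prod, Nat.card_zmod, Nat.card_zmod]
    exact le_of_eq (by ring)
  have hTT := e.isErgodic_prod
  have hTinv := e.not_isErgodic_prod_inv hcard
  have hT3 := e.not_isConservative_power_three hcard
  refine ⟨X, _, ‹_›, μ, ‹_›, T, ?_, ⟨S.F, hS, e.isFunnyRankOneAlong⟩,
    ⟨T.power_two_isErgodic hTT, e.not_isErgodic_power_three hcard⟩,
    e.isConservative_prod_inv hcard, hTinv, hT3,
    fun h => hTinv (MPAction.prod_isErgodic_of_isIsomorphic h hTT)⟩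
  -- A finite `μ` would make the triple product conservative by Poincaré recurrence.
  by_contra hμ
  have : IsFiniteMeasure μ := ⟨lt_top_iff_ne_top.2 hμ⟩
  exact hT3 ((T.power 3).isConservative_of_isFiniteMeasure hz)

/-! ### Change of the acting group -/

namespace MPAction

variable {G H : Type*} [AddCommGroup G] [AddCommGroup H] {X : Type*} [MeasurableSpace X]
  {μ : Measure X}

/-- The action of `H` obtained from an action of an isomorphic group. -/
def comp (T : MPAction G X μ) (φ : H ≃+ G) : MPAction H X μ where
  toFun h := T.toFun (φ h)
  map_zero x := by rw [_root_.map_zero, T.map_zero]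
  map_add g h x := by rw [_root_.map_add, T.map_add]
  measurePreserving h := T.measurePreserving (φ h)

variable (T : MPAction G X μ) (φ : H ≃+ G)

theorem comp_inv : (T.comp φ).inv = T.inv.comp φ := by
  simp [inv, comp]

theorem comp_isErgodic_iff : (T.comp φ).IsErgodic ↔ T.IsErgodic := by
  rw [isErgodic_iff, isErgodic_iff]
  refine forall₂_congr fun B _ => imp_congr_left ?_
  exact φ.surjective.forall (p := fun g => T.toFun g ⁻¹' B =ᵐ[μ] B) |>.symm

theorem comp_isConservative_iff : (T.comp φ).IsConservative ↔ T.IsConservative := by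
  refine forall₃_congr fun B _ _ => ?_
  rw [φ.surjective.exists]
  simp [comp]

theorem comp_isIsomorphic_iff {Y : Type*} [MeasurableSpace Y] {ν : Measure Y}
    (R : MPAction G Y ν) : (T.comp φ).IsIsomorphic (R.comp φ) ↔ T.IsIsomorphic R := by
  refine exists₂_congr fun f f' => and_congr_right fun _ => and_congr_right fun _ =>
    and_congr_right fun _ => and_congr_right fun _ => ?_
  exact (φ.surjective.forall (p := fun g => ∀ᵐ x ∂μ, f (T.toFun g x) = R.toFun g (f x))).symm

theorem IsFunnyRankOneAlong.comp {T : MPAction G X μ} {F : ℕ → Finset G}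
    (h : T.IsFunnyRankOneAlong F) (φ : H ≃+ G) :
    (T.comp φ).IsFunnyRankOneAlong fun n => (F n).map φ.symm.toEquiv.toEmbedding := by
  obtain ⟨A, hA, hdisj, happ⟩ := h
  have hT : ∀ g, (T.comp φ).toFun (φ.symm g) = T.toFun g := fun g => by
    simp [MPAction.comp]
  refine ⟨A, hA, fun n g hg g' hg' hne => ?_, fun B hB hB' => ?_⟩
  · obtain ⟨k, hk, rfl⟩ := Finset.mem_map.1 hg
    obtain ⟨k', hk', rfl⟩ := Finset.mem_map.1 hg'
    have := hdisj n k hk k' hk' fun h => hne (h ▸ rfl)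
    rw [← hT k, ← hT k'] at this
    exact this
  · obtain ⟨D, hD, hlim⟩ := happ B hB hB'
    refine ⟨fun n => (D n).map φ.symm.toEquiv.toEmbedding,
      fun n => Finset.map_subset_map.2 (hD n), ?_⟩
    convert hlim using 4 with n
    ext x
    simp only [Set.mem_iUnion, Finset.mem_map, exists_prop]
    constructor
    · rintro ⟨_, ⟨g, hg, rfl⟩, hx⟩
      exact ⟨g, hg, by rw [← hT g]; exact hx⟩
    · rintro ⟨g, hg, hx⟩
      exact ⟨_, ⟨g, hg, rfl⟩, by rw [← hT g] at hx; exact hx⟩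

end MPAction

/-! ### Cubes in `ℤ^d` and conclusion -/

theorem exists_cube_superset (d : ℕ) (E : Finset (Fin d → ℤ)) :
    ∃ F ∈ {F : Finset (Fin d → ℤ) | ∃ (a : Fin d → ℤ) (N : ℕ), 0 < N ∧
      ∀ x : Fin d → ℤ, x ∈ F ↔ ∀ i, a i ≤ x i ∧ x i < a i + N}, E ⊆ F := by
  let M : ℕ := ∑ x ∈ E, ∑ i, (x i).natAbs
  have hM : ∀ x ∈ E, ∀ i, (x i).natAbs ≤ M := fun x hx i =>
    (Finset.single_le_sum (f := fun i => (x i).natAbs) (fun _ _ => Nat.zero_le _)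
      (Finset.mem_univ i)).trans
      (Finset.single_le_sum (f := fun x : Fin d → ℤ => ∑ i, (x i).natAbs)
        (fun _ _ => Nat.zero_le _) hx)
  refine ⟨Fintype.piFinset fun _ => Finset.Ico (-(M : ℤ)) (-M + (2 * M + 1 : ℕ)),
    ⟨fun _ => -M, 2 * M + 1, by omega, fun x => ?_⟩, fun x hx => ?_⟩
  · simp only [Fintype.mem_piFinset, Finset.mem_Ico]
  · rw [Fintype.mem_piFinset]
    intro i
    have := hM x hx i
    rw [Finset.mem_Ico]
    omega

theorem theorem0p3 :
    (∀ (G : Type*) [AddCommGroup G] [Countable G], (∃ g : G, ¬ IsOfFinAddOrder g) →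
      ∃ (X : Type) (_ : MeasurableSpace X) (_ : StandardBorelSpace X)
        (μ : Measure X) (_ : SigmaFinite μ) (T : MPAction G X μ),
        μ Set.univ = ⊤ ∧
        T.IsFunnyRankOne ∧
        T.HasErgodicIndex 2 ∧
        (T.prod T.inv).IsConservative ∧
        ¬ (T.prod T.inv).IsErgodic ∧
        ¬ (T.power 3).IsConservative ∧
        ¬ T.IsIsomorphic T.inv) ∧
    (∀ d : ℕ, 0 < d →
      ∃ (X : Type) (_ : MeasurableSpace X) (_ : StandardBorelSpace X)
        (μ : Measure X) (_ : SigmaFinite μ) (T : MPAction (Fin d → ℤ) X μ),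
        μ Set.univ = ⊤ ∧
        T.IsRankOne ∧
        T.HasErgodicIndex 2 ∧
        (T.prod T.inv).IsConservative ∧
        ¬ (T.prod T.inv).IsErgodic ∧
        ¬ (T.power 3).IsConservative ∧
        ¬ T.IsIsomorphic T.inv) := by
  refine ⟨fun G _ _ ⟨z, hz⟩ => ?_, fun d hd => ?_⟩
  -- The construction lives in the lowest universe, so a countable `G` is replaced by an isomorphic
  -- copy there and the action is pulled back.
  · let φ : G ≃+ Shrink.{0} G := Shrink.addEquiv.symm
    have hz' : ¬ IsOfFinAddOrder (φ z) := fun h =>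
      hz ((Function.Injective.isOfFinAddOrder_iff (f := φ.toAddMonoidHom) φ.injective).1 h)
    have : Countable (Shrink.{0} G) := φ.symm.injective.countable
    obtain ⟨X, _, _, μ, _, T, h1, ⟨F, -, h2⟩, h3, h4, h5, h6, h7⟩ :=
      exists_action_of_cofinal hz' Set.univ fun E => ⟨E, trivial, le_rfl⟩
    refine ⟨X, _, ‹_›, μ, ‹_›, T.comp φ, h1, ⟨_, h2.comp φ⟩, ?_, ?_, ?_, ?_, ?_⟩
    · exact ⟨((T.power 2).comp_isErgodic_iff φ).2 h3.1,
        fun h => h3.2 (((T.power 3).comp_isErgodic_iff φ).1 h)⟩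
    · rw [T.comp_inv φ]
      exact ((T.prod T.inv).comp_isConservative_iff φ).2 h4
    · rw [T.comp_inv φ]
      exact fun h => h5 (((T.prod T.inv).comp_isErgodic_iff φ).1 h)
    · exact fun h => h6 (((T.power 3).comp_isConservative_iff φ).1 h)
    · rw [T.comp_inv φ, T.comp_isIsomorphic_iff φ]
      exact h7
  · have hz : ¬ IsOfFinAddOrder (fun _ => 1 : Fin d → ℤ) := by
      rw [isOfFinAddOrder_iff_nsmul_eq_zero]
      rintro ⟨n, hn, h⟩
      have := congrFun h ⟨0, hd⟩
      simp at this
      omega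
    obtain ⟨X, _, _, μ, _, T, h1, h2, h3⟩ := exists_action_of_cofinal hz _ (exists_cube_superset d)
    exact ⟨X, _, ‹_›, μ, ‹_›, T, h1, h2, h3⟩
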